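/- Let $k$ be a field and $V$ a finite-dimensional $k$-vector space with a totally ordered basis $X$. Let $c$ be an automorphism of $V\otimes V$ satisfying the braid equation $(c\otimes\mathrm{id})(\mathrm{id}\otimes c)(c\otimes\mathrm{id})=(\mathrm{id}\otimes c)(c\otimes\mathrm{id})(\mathrm{id}\otimes c)$, and assume that $c$ is right triangular with respect to $X$: for all $x,y\in X$ there are $\beta_{x,y}\in k$ and $w_{x,y,z}\in V$ ($z\in X$, $z>x$) with $$c(x\otimes y)=\beta_{x,y}\,y\otimes x+\sum_{z>x}w_{x,y,z}\otimes z .$$ Let $T(V,c)$ be the braided tensor bialgebra: the tensor algebra $T(V)$ with the braiding $\hat c$ induced by $c$ (given on $V^{\otimes n}\otimes V^{\otimes m}$ by $c_{n,m}$, where $c_{0,m}$ and $c_{n,0}$ are identities, $c_{1,1}=c$, $c_{1,m+1}=(\mathrm{id}\otimes c_{1,m})(c\otimes\mathrm{id})$, $c_{n+1,m}=(c_{n,m}\otimes\mathrm{id})(\mathrm{id}\otimes c_{1,m})$), the comultiplication $\Delta_c$ that is an algebra homomorphism to $T(V)\otimes T(V)$ with multiplication $(m\otimes m)(\mathrm{id}\otimes\hat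 c\otimes\mathrm{id})$ and satisfies $\Delta_c(v)=v\otimes1+1\otimes v$ for $v\in V$, and the counit $\varepsilon$ that is an algebra homomorphism vanishing on $V$. A braided biideal of $R=T(V,c)$ is a two-sided ideal $I$ with $\Delta_c(I)\subset R\otimes I+I\otimes R$, $\varepsilon(I)=0$ and $\hat c(R\otimes I+I\otimes R)=R\otimes I+I\otimes R$. Let $\tau$ denote the flip. Let $T(V,\tau c\tau)^{op,cop}$ be $T(V,\tau c\tau)$ with its multiplication $m$, comultiplication $\Delta$ and braiding $\hat d$ replaced by $m\tau$, $\tau\Delta$ and $\tau\hat d\tau$. Let $\varphi:T(V,c)\to T(V,\tau c\tau)^{op,cop}$ be the algebra homomorphism that is the identity on $V$. Identify words in $X$ with the corresponding products in $T(V)$. Words are ordered lexicographically, a proper beginning of a word being smaller than the word. A word is Lyndon if it is nonempty and lexicographically smaller than each of its proper nonempty endings. Write $u\succ v$ if $u$ is shorter than $v$, or if $u,v$ have the same length and $u$ is lexicographically larger than $v$. For a word $u$ let $k\mathbb X_{\succ u}$ be the span of all words $w\succ u$. For a subspace $J\subset T(V)$ let $$S_J=\{u : u \text{ is a Lyndon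 word and } u\notin k\mathbb X_{\succ u}+J\},\qquad h_J(u)=\min\{t\ge1 : u^t\in k\mathbb X_{\succ u^t}+J\}\in\mathbb N\cup\{\infty\}$$ (with $\min\emptyset=\infty$), where $S_J$ is ordered lexicographically. For a totally ordered subset $(S,<)$ of an algebra and $h:S\to\mathbb N\cup\{\infty\}$ the PBW set $B(S,<,h)$ consists of all products $s_1^{e_1}\cdots s_t^{e_t}$ with $t\ge0$, $s_1>\dots>s_t$ in $S$ and $0<e_i<h(s_i)$; the data $(S,<,h)$ form a PBW basis of the algebra if this set is a vector space basis of it. **Theorem.** The map $\varphi$ is an isomorphism of braided bialgebras (i.e. bijective and compatible with units, multiplications, comultiplications, counits and braidings), and $\varphi(v_1\cdots v_n)=v_n\cdots v_1$ for $v_1,\dots,v_n\in V$. Let $I\subsetneq T(V,c)$ be a braided biideal, and let $\pi:T(V,c)\to T(V,c)/I$ be the quotient map. Put $S=\varphi^{-1}(S_{\varphi(I)})$, with the total order given by $s<t$ if and only if $\varphi(t)$ is lexicographically smaller than $\varphi(s)$, and $h=h_{\varphi(I)}\circ\varphi$ on $S$. Then $\pi$ maps $B(S,<,h)$ injectively onto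 a basis of $T(V,c)/I$. In particular $T(V,c)/I$ has a PBW basis, generated by $\pi(S)$ with the order and the heights carried over from $S$ along the bijection $\pi|_S:S\to\pi(S)$. -/

import Mathlib

open scoped TensorProduct

namespace BraidedPBW

noncomputable section

/-! ## Braided vector spaces -/

section Braided

variable {k V ι : Type*} [Field k] [AddCommGroup V] [Module k V]

/-- The braid equation `(c ⊗ id)(id ⊗ c)(c ⊗ id) = (id ⊗ c)(c ⊗ id)(id ⊗ c)` on `V ⊗ V ⊗ V`.
A braided vector space is a space `V` with an automorphism `c` of `V ⊗ V` satisfying it. -/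
def BraidEquation (c : V ⊗[k] V ≃ₗ[k] V ⊗[k] V) : Prop :=
  let c₁₂ : (V ⊗[k] V) ⊗[k] V →ₗ[k] (V ⊗[k] V) ⊗[k] V := c.toLinearMap.rTensor V
  let c₂₃ : (V ⊗[k] V) ⊗[k] V →ₗ[k] (V ⊗[k] V) ⊗[k] V :=
    (TensorProduct.assoc k V V V).symm.toLinearMap ∘ₗ c.toLinearMap.lTensor V ∘ₗ
      (TensorProduct.assoc k V V V).toLinearMap
  c₁₂ ∘ₗ c₂₃ ∘ₗ c₁₂ = c₂₃ ∘ₗ c₁₂ ∘ₗ c₂₃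

/-- `τ c τ`, where `τ` is the flip of `V ⊗ V`. -/
def flipConj (c : V ⊗[k] V ≃ₗ[k] V ⊗[k] V) : V ⊗[k] V ≃ₗ[k] V ⊗[k] V :=
  TensorProduct.comm k V V ≪≫ₗ c ≪≫ₗ TensorProduct.comm k V V

/-- `c` is right triangular with respect to the totally ordered basis `b`:
`c (x ⊗ y) = β x y • (y ⊗ x) + ∑_{z > x} w x y z ⊗ z` for all basis vectors `x`, `y`. -/
def IsRightTriangular [Fintype ι] [LinearOrder ι] (b : Module.Basis ι k V)
    (c : V ⊗[k] V ≃ₗ[k] V ⊗[k] V) : Prop :=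
  ∃ (β : ι → ι → k) (w : ι → ι → ι → V), ∀ x y : ι,
    c (b x ⊗ₜ[k] b y) = β x y • (b y ⊗ₜ[k] b x) +
      ∑ z ∈ Finset.univ.filter (fun z => x < z), w x y z ⊗ₜ[k] b z

end Braided

/-! ## The braided tensor bialgebra `T(V,c)` -/

section TensorBialgebra

variable {k V : Type*} [Field k] [AddCommGroup V] [Module k V]

/-- `t ⊗ (y ⊗ v) ↦ t y ⊗ v`. -/
def absorbLeft : TensorAlgebra k V ⊗[k] (V ⊗[k] V) →ₗ[k] TensorAlgebra k V ⊗[k] V :=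
  (LinearMap.mul' k (TensorAlgebra k V) ∘ₗ
      (TensorAlgebra.ι k).lTensor (TensorAlgebra k V)).rTensor V ∘ₗ
    (TensorProduct.assoc k (TensorAlgebra k V) V V).symm.toLinearMap

/-- `(t ⊗ v) ⊗ s ↦ t ⊗ v s`. -/
def absorbRight : (TensorAlgebra k V ⊗[k] V) ⊗[k] TensorAlgebra k V →ₗ[k]
    TensorAlgebra k V ⊗[k] TensorAlgebra k V :=
  (LinearMap.mul' k (TensorAlgebra k V) ∘ₗ
      (TensorAlgebra.ι k).rTensor (TensorAlgebra k V)).lTensor (TensorAlgebra k V) ∘ₗ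
    (TensorProduct.assoc k (TensorAlgebra k V) V (TensorAlgebra k V)).toLinearMap

/-- For a letter `y`, the operator `t ⊗ v ↦ (t ⊗ 1) · c (v ⊗ y)` on `T(V) ⊗ V`. -/
def passLetter (c : V ⊗[k] V ≃ₗ[k] V ⊗[k] V) :
    V →ₗ[k] Module.End k (TensorAlgebra k V ⊗[k] V) :=
  (LinearMap.compRight k absorbLeft) ∘ₗ LinearMap.lTensorHom (TensorAlgebra k V) ∘ₗ
    (LinearMap.compRight k c.toLinearMap) ∘ₗ (TensorProduct.mk k V V).flip

/-- The maps `c_{1,m} : V ⊗ V^{⊗ m} → V^{⊗ m} ⊗ V`, assembled over all `m`: the letter `v` is moved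
past the letters of a word one after the other, beginning with the leftmost one. -/
def braidOne (c : V ⊗[k] V ≃ₗ[k] V ⊗[k] V) :
    V →ₗ[k] TensorAlgebra k V →ₗ[k] TensorAlgebra k V ⊗[k] V :=
  (LinearMap.lcomp k (TensorAlgebra k V ⊗[k] V) (TensorProduct.mk k (TensorAlgebra k V) V 1) ∘ₗ
    (MulOpposite.opLinearEquiv k).symm.toLinearMap ∘ₗ
    (TensorAlgebra.lift k ((MulOpposite.opLinearEquiv k).toLinearMap ∘ₗ
      passLetter c)).toLinearMap).flip

/-- For a letter `v`, the operator `y ⊗ s ↦ c (v ⊗ y) · (1 ⊗ s)` on `T(V) ⊗ T(V)`. -/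
def braidOneOp (c : V ⊗[k] V ≃ₗ[k] V ⊗[k] V) :
    V →ₗ[k] Module.End k (TensorAlgebra k V ⊗[k] TensorAlgebra k V) :=
  (LinearMap.compRight k absorbRight) ∘ₗ LinearMap.rTensorHom (TensorAlgebra k V) ∘ₗ braidOne c

/-- The braiding of `T(V)` induced by `c`, i.e. the maps
`c_{n,m} : V^{⊗ n} ⊗ V^{⊗ m} → V^{⊗ m} ⊗ V^{⊗ n}` assembled over all `n` and `m`: the letters of the
first word are moved past the second word one after the other, beginning with the rightmost one.
The defining recursions are recorded in the lemmas below. -/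
def braiding (c : V ⊗[k] V ≃ₗ[k] V ⊗[k] V) :
    TensorAlgebra k V ⊗[k] TensorAlgebra k V →ₗ[k] TensorAlgebra k V ⊗[k] TensorAlgebra k V :=
  TensorProduct.lift
    (LinearMap.lcomp k (TensorAlgebra k V ⊗[k] TensorAlgebra k V)
        ((TensorProduct.mk k (TensorAlgebra k V) (TensorAlgebra k V)).flip 1) ∘ₗ
      (TensorAlgebra.lift k (braidOneOp c)).toLinearMap)

/-- The multiplication `(m ⊗ m)(id ⊗ c ⊗ id)` on `T(V) ⊗ T(V)`. -/
def braidedMul (c : V ⊗[k] V ≃ₗ[k] V ⊗[k] V) :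
    (TensorAlgebra k V ⊗[k] TensorAlgebra k V) ⊗[k] (TensorAlgebra k V ⊗[k] TensorAlgebra k V)
      →ₗ[k] TensorAlgebra k V ⊗[k] TensorAlgebra k V :=
  let T := TensorAlgebra k V
  TensorProduct.map (LinearMap.mul' k T) (LinearMap.mul' k T) ∘ₗ
    (TensorProduct.assoc k T T (T ⊗[k] T)).symm.toLinearMap ∘ₗ
    ((TensorProduct.assoc k T T T).toLinearMap ∘ₗ (braiding c).rTensor T ∘ₗ
      (TensorProduct.assoc k T T T).symm.toLinearMap).lTensor T ∘ₗ
    (TensorProduct.assoc k T T (T ⊗[k] T)).toLinearMap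

/-- Left multiplication by `v ⊗ 1 + 1 ⊗ v` with respect to `braidedMul c`. -/
def primitiveMul (c : V ⊗[k] V ≃ₗ[k] V ⊗[k] V) :
    V →ₗ[k] Module.End k (TensorAlgebra k V ⊗[k] TensorAlgebra k V) :=
  TensorProduct.curry (braidedMul c) ∘ₗ
    ((TensorProduct.mk k (TensorAlgebra k V) (TensorAlgebra k V)).flip 1 ∘ₗ TensorAlgebra.ι k +
      TensorProduct.mk k (TensorAlgebra k V) (TensorAlgebra k V) 1 ∘ₗ TensorAlgebra.ι k)

/-- The comultiplication of `T(V,c)`: the algebra homomorphism from `T(V)` to `T(V) ⊗ T(V)` with the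
multiplication `braidedMul c` that sends `v ∈ V` to `v ⊗ 1 + 1 ⊗ v`, so that
`Δ (v₁ ⋯ vₙ) = Δ v₁ · (Δ v₂ · (⋯ (Δ vₙ · (1 ⊗ 1))))`. -/
def comul (c : V ⊗[k] V ≃ₗ[k] V ⊗[k] V) :
    TensorAlgebra k V →ₗ[k] TensorAlgebra k V ⊗[k] TensorAlgebra k V :=
  LinearMap.applyₗ ((1 : TensorAlgebra k V) ⊗ₜ[k] (1 : TensorAlgebra k V)) ∘ₗ
    (TensorAlgebra.lift k (primitiveMul c)).toLinearMap

/-- The counit of `T(V)`: the algebra homomorphism that vanishes on `V`. -/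
def counit : TensorAlgebra k V →ₐ[k] k :=
  TensorAlgebra.algebraMapInv

/-- The subspace `R ⊗ I + I ⊗ R` of `R ⊗ R`, for `R = T(V)`. -/
def sumTensor (I : Submodule k (TensorAlgebra k V)) :
    Submodule k (TensorAlgebra k V ⊗[k] TensorAlgebra k V) :=
  LinearMap.range (I.subtype.lTensor (TensorAlgebra k V)) ⊔
    LinearMap.range (I.subtype.rTensor (TensorAlgebra k V))

/-- A two-sided ideal `I` of `R = T(V,c)` is a braided biideal if it is a coideal and
`c (R ⊗ I + I ⊗ R) = R ⊗ I + I ⊗ R`. -/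
structure IsBraidedBiideal (c : V ⊗[k] V ≃ₗ[k] V ⊗[k] V) (I : Ideal (TensorAlgebra k V))
    [I.IsTwoSided] : Prop where
  comul_mem : ∀ x ∈ I, comul c x ∈ sumTensor (I.restrictScalars k)
  counit_eq_zero : ∀ x ∈ I, counit (k := k) (V := V) x = 0
  map_braiding : (sumTensor (I.restrictScalars k)).map (braiding c) =
    sumTensor (I.restrictScalars k)

/-- The map `φ : T(V) → T(V)`, the algebra homomorphism to the opposite algebra that is the identity
on `V`. -/
def reversal : TensorAlgebra k V →ₗ[k] TensorAlgebra k V :=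
  (MulOpposite.opLinearEquiv k).symm.toLinearMap ∘ₗ
    (TensorAlgebra.lift k
      ((MulOpposite.opLinearEquiv k).toLinearMap ∘ₗ TensorAlgebra.ι k)).toLinearMap

/-- `f` is an isomorphism of braided bialgebras from `T(V,c)` to `T(V,τcτ)^{op,cop}`, the latter
having multiplication `m τ`, comultiplication `τ Δ`, the unit and counit of `T(V,τcτ)`, and
braiding `τ ĉ τ`, where `m`, `Δ`, `ĉ` are those of `T(V,τcτ)`. -/
structure IsIsoToOpCop (c : V ⊗[k] V ≃ₗ[k] V ⊗[k] V)
    (f : TensorAlgebra k V →ₗ[k] TensorAlgebra k V) : Prop where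
  bijective : Function.Bijective f
  map_one : f 1 = 1
  map_mul : ∀ x y, f (x * y) = f y * f x
  map_comul : ∀ x, TensorProduct.map f f (comul c x) =
    TensorProduct.comm k (TensorAlgebra k V) (TensorAlgebra k V) (comul (flipConj c) (f x))
  map_counit : ∀ x, counit (k := k) (V := V) (f x) = counit (k := k) (V := V) x
  map_braiding : ∀ z, TensorProduct.map f f (braiding c z) =
    TensorProduct.comm k (TensorAlgebra k V) (TensorAlgebra k V)
      (braiding (flipConj c)
        (TensorProduct.comm k (TensorAlgebra k V) (TensorAlgebra k V)
          (TensorProduct.map f f z)))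

/-! ### The recursions for the braiding and the comultiplication -/

theorem passLetter_tmul (c : V ⊗[k] V ≃ₗ[k] V ⊗[k] V) (t : TensorAlgebra k V) (v y : V) :
    passLetter c y (t ⊗ₜ[k] v) = absorbLeft (t ⊗ₜ[k] c (v ⊗ₜ[k] y)) := rfl

theorem braidOneOp_tmul (c : V ⊗[k] V ≃ₗ[k] V ⊗[k] V) (v : V) (y s : TensorAlgebra k V) :
    braidOneOp c v (y ⊗ₜ[k] s) = absorbRight (braidOne c v y ⊗ₜ[k] s) := rfl

/-- `c_{1,0} = id`. -/
theorem braidOne_one (c : V ⊗[k] V ≃ₗ[k] V ⊗[k] V) (v : V) :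
    braidOne c v 1 = 1 ⊗ₜ[k] v := by
  simp [braidOne]

theorem absorbLeft_tmul (t : TensorAlgebra k V) (y v : V) :
    absorbLeft (t ⊗ₜ[k] (y ⊗ₜ[k] v)) = (t * TensorAlgebra.ι k y) ⊗ₜ[k] v := by
  simp [absorbLeft]

theorem absorbRight_tmul (t s : TensorAlgebra k V) (v : V) :
    absorbRight ((t ⊗ₜ[k] v) ⊗ₜ[k] s) = t ⊗ₜ[k] (TensorAlgebra.ι k v * s) := by
  simp [absorbRight]

/-- The recursion for `c_{1,m}`, in the form `c_{1,m+1} = (id ⊗ c)(c_{1,m} ⊗ id)`. -/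
theorem braidOne_mul_ι (c : V ⊗[k] V ≃ₗ[k] V ⊗[k] V) (v y : V) (x : TensorAlgebra k V) :
    braidOne c v (x * TensorAlgebra.ι k y) = passLetter c y (braidOne c v x) := by
  simp [braidOne]

theorem braidOne_ι (c : V ⊗[k] V ≃ₗ[k] V ⊗[k] V) (v y : V) :
    braidOne c v (TensorAlgebra.ι k y) =
      (TensorAlgebra.ι k).rTensor V (c (v ⊗ₜ[k] y)) := by
  have h := braidOne_mul_ι c v y 1
  rw [one_mul, braidOne_one, passLetter_tmul] at h
  rw [h]
  induction c (v ⊗ₜ[k] y) using TensorProduct.induction_on with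
  | zero => simp
  | tmul a b => simp [absorbLeft_tmul]
  | add a b ha hb => simp only [TensorProduct.tmul_add, map_add, ha, hb]

/-- `c_{0,m} = id`. -/
theorem braiding_one_tmul (c : V ⊗[k] V ≃ₗ[k] V ⊗[k] V) (y : TensorAlgebra k V) :
    braiding c (1 ⊗ₜ[k] y) = y ⊗ₜ[k] 1 := by
  simp [braiding]

/-- The recursion for `c_{n,m}`, in the form `c_{n+1,m} = (c_{1,m} ⊗ id)(id ⊗ c_{n,m})`. -/
theorem braiding_ι_mul_tmul (c : V ⊗[k] V ≃ₗ[k] V ⊗[k] V) (v : V) (x y : TensorAlgebra k V) :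
    braiding c ((TensorAlgebra.ι k v * x) ⊗ₜ[k] y) = braidOneOp c v (braiding c (x ⊗ₜ[k] y)) := by
  simp [braiding]

/-- On `V ⊗ T(V)` the braiding is given by the maps `c_{1,m}`. -/
theorem braiding_ι_tmul (c : V ⊗[k] V ≃ₗ[k] V ⊗[k] V) (v : V) (y : TensorAlgebra k V) :
    braiding c (TensorAlgebra.ι k v ⊗ₜ[k] y) =
      (TensorAlgebra.ι k).lTensor (TensorAlgebra k V) (braidOne c v y) := by
  have h := braiding_ι_mul_tmul c v 1 y
  rw [mul_one, braiding_one_tmul, braidOneOp_tmul] at h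
  rw [h]
  induction braidOne c v y using TensorProduct.induction_on with
  | zero => simp
  | tmul a b => simp [absorbRight_tmul]
  | add a b ha hb => simp only [TensorProduct.add_tmul, map_add, ha, hb]

theorem braidedMul_tmul (c : V ⊗[k] V ≃ₗ[k] V ⊗[k] V) (x y z w : TensorAlgebra k V) :
    braidedMul c ((x ⊗ₜ[k] y) ⊗ₜ[k] (z ⊗ₜ[k] w)) =
      TensorProduct.map (LinearMap.mulLeft k x) (LinearMap.mulRight k w)
        (braiding c (y ⊗ₜ[k] z)) := by
  simp only [braidedMul, LinearMap.comp_apply, LinearEquiv.coe_coe, TensorProduct.assoc_tmul,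
    LinearMap.lTensor_tmul, TensorProduct.assoc_symm_tmul, LinearMap.rTensor_tmul]
  induction braiding c (y ⊗ₜ[k] z) using TensorProduct.induction_on with
  | zero => simp
  | tmul a b => simp
  | add a b ha hb => simp only [TensorProduct.tmul_add, TensorProduct.add_tmul, map_add, ha, hb]

theorem comul_one (c : V ⊗[k] V ≃ₗ[k] V ⊗[k] V) : comul c 1 = 1 ⊗ₜ[k] 1 := by
  simp [comul]

theorem comul_ι_mul (c : V ⊗[k] V ≃ₗ[k] V ⊗[k] V) (v : V) (x : TensorAlgebra k V) :
    comul c (TensorAlgebra.ι k v * x) =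
      braidedMul c ((TensorAlgebra.ι k v ⊗ₜ[k] 1 + 1 ⊗ₜ[k] TensorAlgebra.ι k v) ⊗ₜ[k]
        comul c x) := by
  simp [comul, primitiveMul, TensorProduct.add_tmul]

theorem comul_ι (c : V ⊗[k] V ≃ₗ[k] V ⊗[k] V) (v : V) :
    comul c (TensorAlgebra.ι k v) =
      TensorAlgebra.ι k v ⊗ₜ[k] 1 + 1 ⊗ₜ[k] TensorAlgebra.ι k v := by
  have h := comul_ι_mul c v 1
  rw [mul_one, comul_one, TensorProduct.add_tmul, map_add, braidedMul_tmul, braidedMul_tmul,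
    braiding_one_tmul, braiding_ι_tmul, braidOne_one] at h
  simpa using h

end TensorBialgebra

/-! ## Words -/

section Words

variable {ι : Type*} [LinearOrder ι]

/-- The lexicographical order on words (a proper beginning of a word is smaller than the word). -/
def LexLT (u v : FreeMonoid ι) : Prop :=
  FreeMonoid.toList u < FreeMonoid.toList v

/-- The word `u` is larger than the word `v` in the standard order: it is shorter than `v`, or it
has the same length and is lexicographically larger. -/
def StdGT (u v : FreeMonoid ι) : Prop :=
  u.length < v.length ∨ (u.length = v.length ∧ LexLT v u)

/-- Lyndon words: nonempty words that are smaller than each of their proper endings. -/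
def IsLyndon (u : FreeMonoid ι) : Prop :=
  u ≠ 1 ∧ ∀ v w : FreeMonoid ι, v ≠ 1 → w ≠ 1 → u = v * w → LexLT u w

variable {k V : Type*} [Field k] [AddCommGroup V] [Module k V]

/-- The basis element of `T(V)` at a word is the product of the letters of the word. -/
theorem tensorAlgebra_basis_eq_prod (b : Module.Basis ι k V) (u : FreeMonoid ι) :
    b.tensorAlgebra u = (u.toList.map (fun i => TensorAlgebra.ι k (b i))).prod := by
  have h : b.tensorAlgebra u = (TensorAlgebra.equivFreeAlgebra b).symm
      (FreeAlgebra.equivMonoidAlgebraFreeMonoid.symm (MonoidAlgebra.of k _ u)) := rfl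
  rw [h]
  clear h
  induction u using FreeMonoid.inductionOn' with
  | one => rw [map_one, map_one, map_one]; rfl
  | of_mul x xs ih =>
    rw [map_mul, map_mul, map_mul, ih]
    simp [FreeAlgebra.equivMonoidAlgebraFreeMonoid]

/-- The span `k𝕏_{≻u}` of all words larger than `u` in the standard order. The word
`x₁ ⋯ xₙ` is identified with the product `b x₁ ⋯ b xₙ` in `T(V)`, which is `b.tensorAlgebra` of
it. -/
def spanAbove (b : Module.Basis ι k V) (u : FreeMonoid ι) : Submodule k (TensorAlgebra k V) :=
  Submodule.span k (b.tensorAlgebra '' {w | StdGT w u})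

/-- The set `S_J` of all Lyndon words `u` with `u ∉ k𝕏_{≻u} + J`, as a subset of `T(V)`. -/
def hardWords (b : Module.Basis ι k V) (J : Submodule k (TensorAlgebra k V)) :
    Set (TensorAlgebra k V) :=
  b.tensorAlgebra '' {u | IsLyndon u ∧ b.tensorAlgebra u ∉ spanAbove b u ⊔ J}

/-- The height of a word `u`: the least positive integer `t` with `u ^ t ∈ k𝕏_{≻u^t} + J`, and `∞`
if there is none. -/
def wordHeight (b : Module.Basis ι k V) (J : Submodule k (TensorAlgebra k V))
    (u : FreeMonoid ι) : ℕ∞ :=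
  sInf {t : ℕ∞ | ∃ n : ℕ, 1 ≤ n ∧ t = n ∧
    b.tensorAlgebra (u ^ n) ∈ spanAbove b (u ^ n) ⊔ J}

/-- The height function `h_J` on words, the words being regarded as elements of `T(V)`. (Distinct
words are distinct elements, so the infimum is over a single word if `a` is a word.) -/
def height (b : Module.Basis ι k V) (J : Submodule k (TensorAlgebra k V))
    (a : TensorAlgebra k V) : ℕ∞ :=
  ⨅ (u : FreeMonoid ι) (_ : b.tensorAlgebra u = a), wordHeight b J u

/-- The lexicographical order on words, the words being regarded as elements of `T(V)`. -/
def ElemLexLT (b : Module.Basis ι k V) (x y : TensorAlgebra k V) : Prop :=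
  ∃ u v : FreeMonoid ι, b.tensorAlgebra u = x ∧ b.tensorAlgebra v = y ∧ LexLT u v

end Words

/-! ## PBW bases -/

section PBW

variable {A : Type*} [Ring A]

/-- The PBW set generated by `P`, `(S,<)` and `h`: all products `s₁^{e₁} ⋯ s_t^{e_t} p` with
`t ≥ 0`, `s₁ > ⋯ > s_t` in `S`, `0 < e_i < h (s_i)` and `p ∈ P`. -/
def pbwSet (P S : Set A) (lt : S → S → Prop) (h : S → ℕ∞) : Set A :=
  {a | ∃ (l : List (S × ℕ)) (p : A), p ∈ P ∧
    l.Pairwise (fun x y => lt y.1 x.1) ∧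
    (∀ x ∈ l, 0 < x.2 ∧ (x.2 : ℕ∞) < h x.1) ∧
    a = (l.map (fun x => (x.1 : A) ^ x.2)).prod * p}

/-- `(P,S,<,h)` is a PBW basis of the algebra `A`: `<` is a total order on `S`, and the PBW set is a
basis of `A`. -/
def IsPBWBasis (k : Type*) [Field k] [Algebra k A] (P S : Set A) (lt : S → S → Prop)
    (h : S → ℕ∞) : Prop :=
  IsStrictTotalOrder S lt ∧ LinearIndepOn k id (pbwSet P S lt h) ∧
    Submodule.span k (pbwSet P S lt h) = ⊤

end PBW

end

end BraidedPBW

namespace BraidedPBW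

noncomputable section

/-!
Under the word-reversing isomorphism `φ` the right triangular braiding `c` becomes the left
triangular braiding `d = τ c τ`, and `I` becomes an ideal `J` with
`Δ_d J ⊆ T ⊗ J + J ⊗ T`. For a Lyndon word `w` the iterated braided commutator `g_w` along the
standard factorization has leading word `w`, and `Δ_d g_w` equals `1 ⊗ g_w + w ⊗ 1` up to terms
whose left factor is spanned by words that are larger than `w`. Hence `Δ_d`, contracted in its left
factor with a functional that detects `v ^ r`, peels the power `g_v ^ r` of the smallest Lyndon
factor off a decreasing product of powers. Applied to a linear dependence modulo `J` with a normal
leading term, this shows that decreasing products of normal Lyndon powers are independent modulo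
`J`, so that their leading words are exactly the normal words. These form a basis modulo `J`.
-/

/-! ## Lyndon words -/

section Words

variable {ι : Type*}

/-- The product `⋯ f(v₂)^{e₂} f(v₁)^{e₁}` of powers for the list `(v₁, e₁), (v₂, e₂), …`. The first
entry of the list is the rightmost factor, so that lists that increase in the `vᵢ` give the
decreasing products of a PBW set. -/
def powersProd {κ M : Type*} [Monoid M] (f : κ → M) (q : List (κ × ℕ)) : M :=
  (q.map fun x => f x.1 ^ x.2).reverse.prod

@[simp]
theorem powersProd_nil {κ M : Type*} [Monoid M] (f : κ → M) : powersProd f [] = 1 := rfl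

@[simp]
theorem powersProd_cons {κ M : Type*} [Monoid M] (f : κ → M) (x : κ × ℕ) (q : List (κ × ℕ)) :
    powersProd f (x :: q) = powersProd f q * f x.1 ^ x.2 := by
  simp [powersProd]

theorem length_pow (v : FreeMonoid ι) (n : ℕ) : (v ^ n).length = n * v.length := by
  induction n with
  | zero => simp
  | succ n ih => rw [pow_succ, FreeMonoid.length_mul, ih, Nat.succ_mul]

theorem length_pos_iff {v : FreeMonoid ι} : 0 < v.length ↔ v ≠ 1 :=
  Nat.pos_iff_ne_zero.trans FreeMonoid.length_eq_zero.not

theorem eq_one_or_eq_mul_of (w : FreeMonoid ι) : w = 1 ∨ ∃ u x, w = u * FreeMonoid.of x :=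
  (List.eq_nil_or_concat (FreeMonoid.toList w)).imp_right fun ⟨u, x, h⟩ =>
    ⟨FreeMonoid.ofList u, x, h.trans (List.concat_eq_append ..)⟩

theorem mul_eq_mul_iff {u v s t : FreeMonoid ι} :
    u * v = s * t ↔ (∃ z, s = u * z ∧ v = z * t) ∨ ∃ z, u = s * z ∧ t = z * v :=
  List.append_eq_append_iff

variable [LinearOrder ι]

theorem LexLT.irrefl (u : FreeMonoid ι) : ¬LexLT u u :=
  lt_irrefl (FreeMonoid.toList u)

theorem LexLT.trans {u v w : FreeMonoid ι} (h : LexLT u v) (h' : LexLT v w) : LexLT u w :=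
  lt_trans (a := FreeMonoid.toList u) h h'

theorem lexLT_trichotomy (u v : FreeMonoid ι) : LexLT u v ∨ u = v ∨ LexLT v u :=
  lt_trichotomy (FreeMonoid.toList u) (FreeMonoid.toList v)

theorem LexLT.mul_left {u w : FreeMonoid ι} (h : LexLT u w) (p : FreeMonoid ι) :
    LexLT (p * u) (p * w) :=
  List.append_left_lt h

theorem LexLT.of_mul_left {p u w : FreeMonoid ι} (h : LexLT (p * u) (p * w)) : LexLT u w := by
  rcases lexLT_trichotomy u w with h' | rfl | h'
  · exact h'
  · exact absurd h (LexLT.irrefl _)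
  · exact absurd (h.trans (h'.mul_left p)) (LexLT.irrefl _)

theorem LexLT.mul_right {u w : FreeMonoid ι} (h : LexLT u w) (t : FreeMonoid ι) :
    LexLT u (w * t) :=
  List.Lex.append_right _ _ h

theorem one_lexLT {t : FreeMonoid ι} (ht : t ≠ 1) : LexLT 1 t := by
  cases t with
  | one => exact absurd rfl ht
  | of_mul x t => exact List.nil_lt_cons x (FreeMonoid.toList t)

theorem lexLT_mul_right (u : FreeMonoid ι) {t : FreeMonoid ι} (ht : t ≠ 1) : LexLT u (u * t) := by
  simpa using (one_lexLT ht).mul_left u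

/-- `u` is smaller than `w` because of a difference between two letters, and not because it is a
proper beginning of `w`: every continuation of `u` is smaller than `w`. -/
def Diverges (u w : FreeMonoid ι) : Prop :=
  ∀ s, LexLT (u * s) w

namespace Diverges

variable {u v w : FreeMonoid ι}

theorem lexLT (h : Diverges u w) : LexLT u w := by
  simpa using h 1

theorem trans (h : Diverges u v) (h' : Diverges v w) : Diverges u w :=
  fun s => (h s).trans h'.lexLT

theorem mul_right (h : Diverges u w) (t : FreeMonoid ι) : Diverges u (w * t) :=
  fun s => (h s).mul_right t

theorem mul_mul (h : Diverges u w) (s t : FreeMonoid ι) : Diverges (u * s) (w * t) :=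
  fun z => by simpa only [mul_assoc] using h.mul_right t (s * z)

theorem mul_left (h : Diverges u w) (p : FreeMonoid ι) : Diverges (p * u) (p * w) :=
  fun s => by simpa only [mul_assoc] using (h s).mul_left p

end Diverges

theorem LexLT.exists_eq_mul_or_diverges {u w : FreeMonoid ι} (h : LexLT u w) :
    (∃ t, w = u * t) ∨ Diverges u w := by
  induction u using FreeMonoid.inductionOn' generalizing w with
  | one => exact .inl ⟨w, (one_mul w).symm⟩
  | of_mul x u ih =>
    cases w with
    | one => exact absurd h (List.not_lt_nil _)
    | of_mul y w =>
      rcases List.cons_lt_cons_iff.1 h with hxy | ⟨rfl, huw⟩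
      · exact .inr fun s => List.cons_lt_cons_iff.2 (.inl hxy)
      · rcases ih huw with ⟨t, rfl⟩ | hdiv
        · exact .inl ⟨t, (mul_assoc _ _ _).symm⟩
        · exact .inr (hdiv.mul_left _)

theorem LexLT.diverges {u w : FreeMonoid ι} (h : LexLT u w) (hl : w.length ≤ u.length) :
    Diverges u w := by
  rcases h.exists_eq_mul_or_diverges with ⟨t, rfl⟩ | hdiv
  · obtain rfl : t = 1 := FreeMonoid.length_eq_zero.1 (by rw [FreeMonoid.length_mul] at hl; omega)
    exact absurd (by simpa using h) (LexLT.irrefl u)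
  · exact hdiv

theorem Diverges.of_mul {u s w : FreeMonoid ι} (h : Diverges (u * s) w)
    (hl : w.length ≤ u.length) : Diverges u w := by
  refine LexLT.diverges ?_ hl
  rcases eq_or_ne s 1 with rfl | hs
  · simpa using h.lexLT
  · exact (lexLT_mul_right u hs).trans h.lexLT

end Words

section Lyndon

variable {ι : Type*} [LinearOrder ι]

namespace IsLyndon

theorem of (x : ι) : IsLyndon (FreeMonoid.of x) := by
  refine ⟨FreeMonoid.of_ne_one x, fun v w hv hw h => ?_⟩
  have hlen := congrArg FreeMonoid.length h
  rw [FreeMonoid.length_of, FreeMonoid.length_mul] at hlen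
  have := length_pos_iff.2 hv
  have := length_pos_iff.2 hw
  omega

theorem mul_lexLT_right {u v : FreeMonoid ι} (hv : IsLyndon v) (hu : u ≠ 1) (h : LexLT u v) :
    LexLT (u * v) v := by
  rcases h.exists_eq_mul_or_diverges with ⟨t, rfl⟩ | hdiv
  · have ht : t ≠ 1 := by
      rintro rfl
      exact LexLT.irrefl u (by simpa using h)
    exact (hv.2 u t hu ht rfl).mul_left u
  · exact hdiv v

theorem mul {u v : FreeMonoid ι} (hu : IsLyndon u) (hv : IsLyndon v) (h : LexLT u v) :
    IsLyndon (u * v) := by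
  refine ⟨fun h1 => hu.1 (mul_eq_one'.1 h1).1, fun s t hs ht e => ?_⟩
  have huv := hv.mul_lexLT_right hu.1 h
  rcases mul_eq_mul_iff.1 e with ⟨z, rfl, rfl⟩ | ⟨z, rfl, rfl⟩
  · rcases eq_or_ne z 1 with rfl | hz
    · simpa using huv
    · exact huv.trans (hv.2 z t hz ht rfl)
  · rcases eq_or_ne z 1 with rfl | hz
    · simpa using huv
    · have hlt : LexLT (s * z) z := hu.2 s z hs hz rfl
      exact ((hlt.diverges (by simp)).mul_mul v v).lexLT

end IsLyndon

theorem exists_minimal_proper_ending {w : FreeMonoid ι} (hl : 2 ≤ w.length) :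
    ∃ u v : FreeMonoid ι, u ≠ 1 ∧ v ≠ 1 ∧ w = u * v ∧
      ∀ s t, s ≠ 1 → t ≠ 1 → w = s * t → ¬LexLT t v := by
  obtain ⟨i, hi, hmin⟩ := (Finset.Ico 1 w.length).exists_min_image
    (fun i => (FreeMonoid.toList w).drop i) ⟨1, Finset.mem_Ico.2 ⟨le_rfl, hl⟩⟩
  obtain ⟨h1, hiw⟩ := Finset.mem_Ico.1 hi
  refine ⟨FreeMonoid.ofList ((FreeMonoid.toList w).take i),
    FreeMonoid.ofList ((FreeMonoid.toList w).drop i), length_pos_iff.1 ?_, length_pos_iff.1 ?_,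
    (List.take_append_drop i _).symm, fun s t hs ht hst => ?_⟩
  · exact (List.length_take_of_le hiw.le).trans_ge h1
  · exact (List.length_drop ..).trans_gt (Nat.sub_pos_of_lt hiw)
  · have hs := length_pos_iff.2 hs
    have ht := length_pos_iff.2 ht
    have hlen : w.length = s.length + t.length := by rw [hst, FreeMonoid.length_mul]
    have hdrop : (FreeMonoid.toList w).drop s.length = FreeMonoid.toList t := by
      rw [hst]
      exact List.drop_left
    have hle := hmin s.length (Finset.mem_Ico.2 ⟨hs, by omega⟩)
    rw [hdrop] at hle
    exact not_lt_of_ge hle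

/-- The standard factorization: the right factor is the smallest proper ending of the word. -/
theorem IsLyndon.exists_eq_mul {w : FreeMonoid ι} (hw : IsLyndon w) (hl : 2 ≤ w.length) :
    ∃ u v, IsLyndon u ∧ IsLyndon v ∧ LexLT u v ∧ w = u * v := by
  obtain ⟨u, v, hu, hv, rfl, hmin⟩ := exists_minimal_proper_ending hl
  refine ⟨u, v, ⟨hu, fun s t hs ht e => ?_⟩, ⟨hv, fun s t hs ht e => ?_⟩,
    (lexLT_mul_right u hv).trans (hw.2 u v hu hv rfl), rfl⟩
  · subst e
    rcases lexLT_trichotomy (s * t) t with h | h | h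
    · exact h
    · exact absurd (by simpa using h) hs
    · have hlt : LexLT (s * t * v) (t * v) :=
        hw.2 s (t * v) hs (fun h1 => hv (mul_eq_one'.1 h1).2) (mul_assoc s t v)
      rcases h.exists_eq_mul_or_diverges with ⟨z, hz⟩ | hdiv
      · refine absurd (LexLT.of_mul_left (p := t) ?_)
          (hmin t (z * v) ht (fun h1 => hv (mul_eq_one'.1 h1).2) (by rw [hz, mul_assoc]))
        rwa [← mul_assoc, ← hz]
      · exact absurd (hlt.trans (hdiv.mul_mul v v).lexLT) (LexLT.irrefl _)
  · subst e
    rcases lexLT_trichotomy (s * t) t with h | h | h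
    · exact h
    · exact absurd (by simpa using h) hs
    · exact absurd h (hmin (u * s) t (fun h1 => hs (mul_eq_one'.1 h1).2) ht (mul_assoc u s t).symm)

/-- The words that exceed some power of `v` after a common beginning. -/
def PowerDiverges (v z : FreeMonoid ι) : Prop :=
  ∃ n : ℕ, Diverges (v ^ n) z

namespace PowerDiverges

variable {v z : FreeMonoid ι}

theorem mul_right (h : PowerDiverges v z) (t : FreeMonoid ι) : PowerDiverges v (z * t) :=
  h.imp fun _ h => h.mul_right t

theorem trans {z' : FreeMonoid ι} (h : PowerDiverges v z) (h' : Diverges z z') :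
    PowerDiverges v z' :=
  h.imp fun _ h => h.trans h'

theorem pow_mul (h : PowerDiverges v z) (j : ℕ) : PowerDiverges v (v ^ j * z) := by
  obtain ⟨n, h⟩ := h
  exact ⟨j + n, by rw [pow_add]; exact h.mul_left _⟩

theorem diverges_pow (h : PowerDiverges v z) {r : ℕ} (hl : z.length ≤ r * v.length) :
    Diverges (v ^ r) z := by
  obtain ⟨n, h⟩ := h
  rcases le_total n r with hn | hn <;> obtain ⟨m, rfl⟩ := Nat.exists_eq_add_of_le hn
  · rw [pow_add]
    simpa using h.mul_mul (v ^ m) 1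
  · rw [pow_add] at h
    exact h.of_mul (by rwa [length_pow])

end PowerDiverges

theorem powerDiverges_of_forall_ending {v : FreeMonoid ι} (hv : v ≠ 1) {t : FreeMonoid ι}
    (ht : t ≠ 1) (h : ∀ p s, s ≠ 1 → t = p * s → LexLT v s) : PowerDiverges v t := by
  induction hn : t.length using Nat.strong_induction_on generalizing t with
  | h n ih =>
    have hvt : LexLT v t := h 1 t ht (one_mul t).symm
    rcases hvt.exists_eq_mul_or_diverges with ⟨s, rfl⟩ | hdiv
    · have hs : s ≠ 1 := by
        rintro rfl
        exact LexLT.irrefl v (by simpa using hvt)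
      have hlen : s.length < n := by
        rw [← hn, FreeMonoid.length_mul]
        exact Nat.lt_add_of_pos_left (length_pos_iff.2 hv)
      have hpow := ih _ hlen hs
        (fun p z hz e => h (v * p) z hz (by rw [e, mul_assoc])) rfl
      simpa using hpow.pow_mul 1
    · exact ⟨1, by simpa using hdiv⟩

theorem IsLyndon.powerDiverges {v w : FreeMonoid ι} (hv : IsLyndon v) (hw : IsLyndon w)
    (h : LexLT v w) : PowerDiverges v w := by
  refine powerDiverges_of_forall_ending hv.1 hw.1 fun p s hs e => ?_
  rcases eq_or_ne p 1 with rfl | hp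
  · rwa [← one_mul s, ← e]
  · exact h.trans (hw.2 p s hp hs e)

/-- Lists `(v₁, e₁), (v₂, e₂), …` of Lyndon words `v₁ < v₂ < ⋯` with positive exponents. They
encode the factorizations of words into weakly decreasing Lyndon words. -/
def IsLyndonList (q : List (FreeMonoid ι × ℕ)) : Prop :=
  q.Pairwise (fun x y => LexLT x.1 y.1) ∧ ∀ x ∈ q, IsLyndon x.1 ∧ 0 < x.2

theorem isLyndonList_nil : IsLyndonList ([] : List (FreeMonoid ι × ℕ)) := by
  simp [IsLyndonList]

theorem isLyndonList_cons {v : FreeMonoid ι} {n : ℕ} {q : List (FreeMonoid ι × ℕ)} :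
    IsLyndonList ((v, n) :: q) ↔
      (∀ y ∈ q, LexLT v y.1) ∧ (IsLyndon v ∧ 0 < n) ∧ IsLyndonList q := by
  simp only [IsLyndonList, List.pairwise_cons, List.forall_mem_cons]
  tauto

/-- A Lyndon word `l` larger than the last factor `v` of a factorization is absorbed into the
Lyndon word `v * l`, which is then compared with the preceding factor. -/
theorem exists_isLyndonList_powersProd_mul (u : FreeMonoid ι) {l : FreeMonoid ι}
    (hl : IsLyndon l) : ∃ q, IsLyndonList q ∧ powersProd id q = u * l := by
  induction hn : u.length using Nat.strong_induction_on generalizing u l with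
  | h n ih =>
    obtain ⟨q, hq, rfl⟩ : ∃ q, IsLyndonList q ∧ powersProd id q = u := by
      rcases eq_one_or_eq_mul_of u with rfl | ⟨u, x, rfl⟩
      · exact ⟨[], isLyndonList_nil, rfl⟩
      · exact ih _ (by simp [← hn]) u (.of x) rfl
    rcases q with _ | ⟨⟨v, e⟩, q⟩
    · exact ⟨[(l, 1)], isLyndonList_cons.2 ⟨by simp, ⟨hl, one_pos⟩, hq⟩, by simp⟩
    obtain ⟨hvq, ⟨hv, he⟩, hq'⟩ := isLyndonList_cons.1 hq
    rcases lexLT_trichotomy l v with h | rfl | h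
    · refine ⟨(l, 1) :: (v, e) :: q, isLyndonList_cons.2 ⟨?_, ⟨hl, one_pos⟩, hq⟩, by simp⟩
      exact List.forall_mem_cons.2 ⟨h, fun y hy => h.trans (hvq y hy)⟩
    · exact ⟨(l, e + 1) :: q, isLyndonList_cons.2 ⟨hvq, ⟨hl, e.succ_pos⟩, hq'⟩,
        by simp [pow_succ, mul_assoc]⟩
    · obtain ⟨m, rfl⟩ := Nat.exists_eq_succ_of_ne_zero he.ne'
      obtain ⟨q', hq', e'⟩ := ih _ (by simp [← hn, length_pow, length_pos_iff.2 hv.1, Nat.succ_mul])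
        (powersProd id q * v ^ m) (hv.mul hl h) rfl
      exact ⟨q', hq', by simp [e', pow_succ, mul_assoc]⟩

theorem exists_isLyndonList_powersProd (w : FreeMonoid ι) :
    ∃ q, IsLyndonList q ∧ powersProd id q = w := by
  rcases eq_one_or_eq_mul_of w with rfl | ⟨u, x, rfl⟩
  · exact ⟨[], isLyndonList_nil, rfl⟩
  · exact exists_isLyndonList_powersProd_mul u (.of x)

end Lyndon

/-! ## The braided product -/

section BraidedProduct

variable {k V : Type*} [Field k] [AddCommGroup V] [Module k V]

local notation "T" => TensorAlgebra k V

/-- The left `A`-linear extension `a ⊗ m ↦ a • f m` of `f` to `A ⊗ M`. The algebra `A` need not be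
commutative. -/
def extendLeft {A M P : Type*} [Semiring A] [Algebra k A] [AddCommMonoid M] [Module k M]
    [AddCommMonoid P] [Module k P] [Module A P] [IsScalarTower k A P] :
    (M →ₗ[k] P) →ₗ[k] A ⊗[k] M →ₗ[A] P :=
  TensorProduct.AlgebraTensorModule.uncurry k A k A M P ∘ₗ
    (LinearMap.ringLmapEquivSelf A k (M →ₗ[k] P)).symm.toLinearMap

/-- The operator `x ⊗ y ↦ x ⊗ y s` on `T(V) ⊗ T(V)`. -/
def mulRightSnd (s : T) : T ⊗[k] T →ₗ[T] T ⊗[k] T :=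
  (LinearMap.mulRight k s).baseChange T

@[simp]
theorem mulRightSnd_tmul (s x y : T) : mulRightSnd s (x ⊗ₜ[k] y) = x ⊗ₜ[k] (y * s) := rfl

theorem absorbLeft_mul_tmul (t x : T) (Y : V ⊗[k] V) :
    absorbLeft ((t * x) ⊗ₜ[k] Y) = t • absorbLeft (x ⊗ₜ[k] Y) := by
  induction Y using TensorProduct.induction_on with
  | zero => simp
  | tmul v w => simp only [absorbLeft_tmul, TensorProduct.smul_tmul', smul_eq_mul, mul_assoc]
  | add Y Z hY hZ => simp only [TensorProduct.tmul_add, map_add, smul_add, hY, hZ]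

theorem absorbRight_smul_tmul (t x : T) (Y : T ⊗[k] V) :
    absorbRight ((t • Y) ⊗ₜ[k] x) = t • absorbRight (Y ⊗ₜ[k] x) := by
  induction Y using TensorProduct.induction_on with
  | zero => simp
  | tmul y v => simp only [absorbRight_tmul, TensorProduct.smul_tmul', smul_eq_mul]
  | add Y Z hY hZ => simp only [TensorProduct.add_tmul, map_add, smul_add, hY, hZ]

theorem absorbRight_tmul_mul (Y : T ⊗[k] V) (x s : T) :
    absorbRight (Y ⊗ₜ[k] (x * s)) = mulRightSnd s (absorbRight (Y ⊗ₜ[k] x)) := by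
  induction Y using TensorProduct.induction_on with
  | zero => simp
  | tmul y v => simp only [absorbRight_tmul, mulRightSnd_tmul, mul_assoc]
  | add Y Z hY hZ => simp only [TensorProduct.add_tmul, map_add, hY, hZ]

variable (c : V ⊗[k] V ≃ₗ[k] V ⊗[k] V)

/-- The operator `y ⊗ z ↦ c (x ⊗ y) · (1 ⊗ z)` on `T(V) ⊗ T(V)`, as an action of `x`. -/
def braidOp : T →ₐ[k] Module.End k (T ⊗[k] T) :=
  TensorAlgebra.lift k (braidOneOp c)

/-- The operator `y ⊗ v ↦ (y ⊗ 1) · c (v ⊗ z)` on `T(V) ⊗ V`, as a function of `z`. -/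
def braidOneRight : T →ₗ[k] T ⊗[k] V →ₗ[T] T ⊗[k] V :=
  extendLeft ∘ₗ (braidOne c).flip

/-- The operator `y ⊗ x ↦ (y ⊗ 1) · c (x ⊗ z)` on `T(V) ⊗ T(V)`, as a function of `z`. -/
def braidOpRight : T →ₗ[k] T ⊗[k] T →ₗ[T] T ⊗[k] T :=
  extendLeft ∘ₗ (TensorProduct.curry (braiding c)).flip

/-- The operator `y ⊗ z ↦ (t ⊗ 1) · c (v ⊗ y) · (1 ⊗ z)` for `t ⊗ v` in `T(V) ⊗ V`. -/
def smulBraidOneOp : T ⊗[k] V →ₗ[T] Module.End k (T ⊗[k] T) :=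
  extendLeft (braidOneOp c)

@[simp]
theorem braidOp_ι (v : V) : braidOp c (TensorAlgebra.ι k v) = braidOneOp c v :=
  TensorAlgebra.lift_ι_apply ..

@[simp]
theorem braidOneRight_tmul (z y : T) (v : V) :
    braidOneRight c z (y ⊗ₜ[k] v) = y • braidOne c v z := rfl

@[simp]
theorem braidOpRight_tmul (z y x : T) :
    braidOpRight c z (y ⊗ₜ[k] x) = y • braiding c (x ⊗ₜ[k] z) := rfl

@[simp]
theorem smulBraidOneOp_tmul (t : T) (v : V) (X : T ⊗[k] T) :
    smulBraidOneOp c (t ⊗ₜ[k] v) X = t • braidOneOp c v X := rfl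

theorem braiding_eq_braidOp (x y : T) :
    braiding c (x ⊗ₜ[k] y) = braidOp c x (y ⊗ₜ[k] 1) := rfl

theorem braiding_mul_tmul (x y z : T) :
    braiding c ((x * y) ⊗ₜ[k] z) = braidOp c x (braiding c (y ⊗ₜ[k] z)) := by
  simp only [braiding_eq_braidOp, map_mul, Module.End.mul_apply]

theorem braidOneOp_mulRightSnd (v : V) (s : T) (X : T ⊗[k] T) :
    braidOneOp c v (mulRightSnd s X) = mulRightSnd s (braidOneOp c v X) := by
  induction X using TensorProduct.induction_on with
  | zero => simp
  | tmul x y => simp only [braidOneOp_tmul, mulRightSnd_tmul, absorbRight_tmul_mul]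
  | add X Y hX hY => simp only [map_add, hX, hY]

theorem braidOp_mulRightSnd (x s : T) (X : T ⊗[k] T) :
    braidOp c x (mulRightSnd s X) = mulRightSnd s (braidOp c x X) := by
  induction x using TensorAlgebra.induction generalizing X with
  | algebraMap r => simp only [AlgHom.commutes, Module.algebraMap_end_apply,
      LinearMap.map_smul_of_tower]
  | ι v => simp only [braidOp_ι, braidOneOp_mulRightSnd]
  | mul x y hx hy => simp only [map_mul, Module.End.mul_apply, hx, hy]
  | add x y hx hy => simp only [map_add, LinearMap.add_apply, hx, hy]

theorem braidOp_tmul (x y z : T) :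
    braidOp c x (y ⊗ₜ[k] z) = mulRightSnd z (braiding c (x ⊗ₜ[k] y)) := by
  rw [braiding_eq_braidOp, ← braidOp_mulRightSnd, mulRightSnd_tmul, one_mul]

theorem braidOneRight_one (Y : T ⊗[k] V) : braidOneRight c 1 Y = Y := by
  induction Y using TensorProduct.induction_on with
  | zero => simp
  | tmul t v =>
    rw [braidOneRight_tmul, braidOne_one, TensorProduct.smul_tmul', smul_eq_mul, mul_one]
  | add X Y hX hY => simp only [map_add, hX, hY]

theorem passLetter_eq_braidOneRight (y : V) (Y : T ⊗[k] V) :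
    passLetter c y Y = braidOneRight c (TensorAlgebra.ι k y) Y := by
  induction Y using TensorProduct.induction_on with
  | zero => simp
  | tmul t v =>
    rw [braidOneRight_tmul, ← one_mul (TensorAlgebra.ι k y), braidOne_mul_ι, braidOne_one,
      passLetter_tmul, passLetter_tmul, ← absorbLeft_mul_tmul, mul_one]
  | add X Y hX hY => simp only [map_add, hX, hY]

theorem braidOne_mul (v : V) (y z : T) :
    braidOne c v (y * z) = braidOneRight c z (braidOne c v y) := by
  induction z using TensorAlgebra.induction generalizing v y with
  | ι w => rw [braidOne_mul_ι, passLetter_eq_braidOneRight]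
  | algebraMap r =>
    rw [Algebra.algebraMap_eq_smul_one, mul_smul_comm, mul_one, map_smul, map_smul,
      LinearMap.smul_apply, braidOneRight_one]
  | mul a b ha hb =>
    rw [← mul_assoc, hb, ha]
    induction braidOne c v y using TensorProduct.induction_on with
    | zero => simp
    | tmul t u => simp only [braidOneRight_tmul, map_smul, hb]
    | add X Y hX hY => simp only [map_add, hX, hY]
  | add a b ha hb => rw [mul_add, map_add, ha, hb, map_add, LinearMap.add_apply]

theorem braidOneOp_smul (v : V) (y : T) (X : T ⊗[k] T) :
    braidOneOp c v (y • X) = smulBraidOneOp c (braidOne c v y) X := by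
  induction X using TensorProduct.induction_on with
  | zero => simp
  | add X Y hX hY => simp only [smul_add, map_add, hX, hY]
  | tmul z x =>
    rw [TensorProduct.smul_tmul', smul_eq_mul, braidOneOp_tmul, braidOne_mul]
    induction braidOne c v y using TensorProduct.induction_on with
    | zero => simp
    | add X Y hX hY => simp only [map_add, TensorProduct.add_tmul, LinearMap.add_apply, hX, hY]
    | tmul t w =>
      rw [braidOneRight_tmul, smulBraidOneOp_tmul, absorbRight_smul_tmul, braidOneOp_tmul]

theorem braidOpRight_absorbRight (z x : T) (Y : T ⊗[k] V) :
    braidOpRight c z (absorbRight (Y ⊗ₜ[k] x)) = smulBraidOneOp c Y (braiding c (x ⊗ₜ[k] z)) := by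
  induction Y using TensorProduct.induction_on with
  | zero => simp
  | add X Y hX hY => simp only [map_add, TensorProduct.add_tmul, LinearMap.add_apply, hX, hY]
  | tmul t v => rw [absorbRight_tmul, braidOpRight_tmul, smulBraidOneOp_tmul, braiding_ι_mul_tmul]

theorem braidOp_braidOpRight (x z : T) (X : T ⊗[k] T) :
    braidOp c x (braidOpRight c z X) = braidOpRight c z (braidOp c x X) := by
  induction x using TensorAlgebra.induction generalizing X with
  | algebraMap r => simp only [AlgHom.commutes, Module.algebraMap_end_apply,
      LinearMap.map_smul_of_tower]
  | mul a b ha hb => simp only [map_mul, Module.End.mul_apply, ha, hb]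
  | add a b ha hb => simp only [map_add, LinearMap.add_apply, ha, hb]
  | ι v =>
    induction X using TensorProduct.induction_on with
    | zero => simp
    | add X Y hX hY => simp only [map_add, hX, hY]
    | tmul y x =>
      rw [braidOp_ι, braidOpRight_tmul, braidOneOp_smul, braidOneOp_tmul, braidOpRight_absorbRight]

theorem braiding_tmul_mul (x y z : T) :
    braiding c (x ⊗ₜ[k] (y * z)) = braidOpRight c z (braiding c (x ⊗ₜ[k] y)) := by
  rw [braiding_eq_braidOp c x y, ← braidOp_braidOpRight, braidOpRight_tmul, braiding_one_tmul,
    TensorProduct.smul_tmul', smul_eq_mul, braiding_eq_braidOp]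

theorem braidedMul_tmul_left (x y : T) (Y : T ⊗[k] T) :
    braidedMul c ((x ⊗ₜ[k] y) ⊗ₜ[k] Y) = x • braidOp c y Y := by
  induction Y using TensorProduct.induction_on with
  | zero => simp
  | add X Y hX hY => simp only [map_add, TensorProduct.tmul_add, smul_add, hX, hY]
  | tmul z w =>
    rw [braidedMul_tmul, braidOp_tmul]
    induction braiding c (y ⊗ₜ[k] z) using TensorProduct.induction_on with
    | zero => simp
    | add X Y hX hY => simp only [map_add, smul_add, hX, hY]
    | tmul z w => rfl

theorem braidedMul_tmul_right (X : T ⊗[k] T) (p q : T) :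
    braidedMul c (X ⊗ₜ[k] (p ⊗ₜ[k] q)) = mulRightSnd q (braidOpRight c p X) := by
  induction X using TensorProduct.induction_on with
  | zero => simp
  | add X Y hX hY => simp only [map_add, TensorProduct.add_tmul, hX, hY]
  | tmul z w => rw [braidedMul_tmul_left, braidOp_tmul, braidOpRight_tmul, map_smul]

theorem one_braidedMul (Y : T ⊗[k] T) : braidedMul c ((1 ⊗ₜ[k] 1) ⊗ₜ[k] Y) = Y := by
  rw [braidedMul_tmul_left, one_smul, map_one, Module.End.one_apply]

theorem braidedMul_assoc (X Y Z : T ⊗[k] T) :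
    braidedMul c (braidedMul c (X ⊗ₜ[k] Y) ⊗ₜ[k] Z) =
      braidedMul c (X ⊗ₜ[k] braidedMul c (Y ⊗ₜ[k] Z)) := by
  induction X using TensorProduct.induction_on with
  | zero => simp
  | add X X' h h' => simp only [map_add, TensorProduct.add_tmul, h, h']
  | tmul x y =>
    induction Z using TensorProduct.induction_on with
    | zero => simp
    | add Z Z' h h' => simp only [map_add, TensorProduct.tmul_add, h, h']
    | tmul p q =>
      simp only [braidedMul_tmul_left, braidedMul_tmul_right, braidOp_mulRightSnd,
        braidOp_braidOpRight, map_smul]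

theorem lift_primitiveMul_apply (x : T) (Y : T ⊗[k] T) :
    TensorAlgebra.lift k (primitiveMul c) x Y = braidedMul c (comul c x ⊗ₜ[k] Y) := by
  have comul_eq (y : T) : comul c y = TensorAlgebra.lift k (primitiveMul c) y (1 ⊗ₜ[k] 1) := rfl
  induction x using TensorAlgebra.induction generalizing Y with
  | algebraMap r =>
    simp only [comul_eq, AlgHom.commutes, Module.algebraMap_end_apply, ← TensorProduct.smul_tmul',
      map_smul, one_braidedMul]
  | ι v => simp [comul_ι, primitiveMul, TensorProduct.add_tmul]
  | mul x y hx hy =>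
    rw [comul_eq (x * y), map_mul, Module.End.mul_apply, Module.End.mul_apply, ← comul_eq, hx,
      hx, hy, braidedMul_assoc]
  | add x y hx hy => simp only [map_add, LinearMap.add_apply, TensorProduct.add_tmul, hx, hy]

theorem comul_mul (x y : T) : comul c (x * y) = braidedMul c (comul c x ⊗ₜ[k] comul c y) := by
  rw [← lift_primitiveMul_apply]
  simp only [comul, LinearMap.comp_apply, AlgHom.toLinearMap_apply, LinearMap.applyₗ_apply_apply,
    map_mul, Module.End.mul_apply]

end BraidedProduct

/-! ## The word-reversing map -/

section Reversal

variable {k V : Type*} [Field k] [AddCommGroup V] [Module k V]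

local notation "T" => TensorAlgebra k V

@[simp]
theorem reversal_one : reversal (1 : T) = 1 := by simp [reversal]

@[simp]
theorem reversal_algebraMap (r : k) : reversal (algebraMap k T r) = algebraMap k T r := by
  simp [reversal]

@[simp]
theorem reversal_ι (v : V) : reversal (TensorAlgebra.ι k v) = TensorAlgebra.ι k v := by
  simp [reversal]

@[simp]
theorem reversal_mul (x y : T) : reversal (x * y) = reversal y * reversal x := by
  simp [reversal]

@[simp]
theorem reversal_reversal (x : T) : reversal (reversal x) = x := by
  induction x using TensorAlgebra.induction with
  | algebraMap r => simp
  | ι v => simp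
  | mul x y hx hy => simp [hx, hy]
  | add x y hx hy => simp [hx, hy]

theorem reversal_pow (x : T) (n : ℕ) : reversal (x ^ n) = reversal x ^ n := by
  induction n with
  | zero => simp
  | succ n ih => rw [pow_succ, reversal_mul, ih, pow_succ']

theorem reversal_prod (l : List V) : reversal (l.map (TensorAlgebra.ι k)).prod =
    (l.reverse.map (TensorAlgebra.ι k)).prod := by
  induction l with
  | nil => simp
  | cons v l ih => simp [ih]

/-- The map `x ⊗ y ↦ φ y ⊗ φ x` for the word-reversing map `φ`. -/
def revFlip : T ⊗[k] T →ₗ[k] T ⊗[k] T :=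
  (TensorProduct.comm k T T).toLinearMap ∘ₗ TensorProduct.map reversal reversal

@[simp]
theorem revFlip_tmul (x y : T) : revFlip (x ⊗ₜ[k] y) = reversal y ⊗ₜ[k] reversal x := rfl

theorem map_reversal_eq_comm_of_revFlip_eq {X Y : T ⊗[k] T} (h : revFlip X = Y) :
    TensorProduct.map reversal reversal X = TensorProduct.comm k T T Y := by
  rw [← h]
  exact ((TensorProduct.comm k T T).symm_apply_apply _).symm

theorem revFlip_smul (x : T) (X : T ⊗[k] T) :
    revFlip (x • X) = mulRightSnd (reversal x) (revFlip X) := by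
  induction X using TensorProduct.induction_on with
  | zero => simp
  | tmul y z => simp [TensorProduct.smul_tmul']
  | add X Y hX hY => simp only [smul_add, map_add, hX, hY]

theorem revFlip_mulRightSnd (x : T) (X : T ⊗[k] T) :
    revFlip (mulRightSnd x X) = reversal x • revFlip X := by
  induction X using TensorProduct.induction_on with
  | zero => simp
  | tmul y z => simp [TensorProduct.smul_tmul']
  | add X Y hX hY => simp only [smul_add, map_add, hX, hY]

variable (c : V ⊗[k] V ≃ₗ[k] V ⊗[k] V)

theorem braiding_tmul_one (x : T) : braiding c (x ⊗ₜ[k] 1) = 1 ⊗ₜ[k] x := by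
  induction x using TensorAlgebra.induction with
  | algebraMap r =>
    rw [Algebra.algebraMap_eq_smul_one, ← TensorProduct.smul_tmul', map_smul, braiding_one_tmul,
      TensorProduct.tmul_smul]
  | ι v => rw [braiding_ι_tmul, braidOne_one, LinearMap.lTensor_tmul]
  | mul x y hx hy => rw [braiding_mul_tmul, hy, braidOp_tmul, hx, mulRightSnd_tmul]
  | add x y hx hy => rw [TensorProduct.add_tmul, map_add, hx, hy, TensorProduct.tmul_add]

theorem revFlip_braiding_ι_tmul_ι (u v : V) :
    revFlip (braiding c (TensorAlgebra.ι k u ⊗ₜ[k] TensorAlgebra.ι k v)) =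
      braiding (flipConj c) (TensorAlgebra.ι k v ⊗ₜ[k] TensorAlgebra.ι k u) := by
  have hflip : flipConj c (v ⊗ₜ[k] u) = TensorProduct.comm k V V (c (u ⊗ₜ[k] v)) := by
    simp [flipConj]
  rw [braiding_ι_tmul, braiding_ι_tmul, braidOne_ι, braidOne_ι, hflip]
  induction c (u ⊗ₜ[k] v) using TensorProduct.induction_on with
  | zero => simp
  | tmul p q => simp
  | add X Y hX hY => simp only [map_add, hX, hY]

theorem revFlip_braiding_ι_tmul (v : V) (z : T) :
    revFlip (braiding c (TensorAlgebra.ι k v ⊗ₜ[k] z)) =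
      braiding (flipConj c) (reversal z ⊗ₜ[k] TensorAlgebra.ι k v) := by
  induction z using TensorAlgebra.induction generalizing v with
  | algebraMap r =>
    rw [reversal_algebraMap, Algebra.algebraMap_eq_smul_one, TensorProduct.tmul_smul, map_smul,
      braiding_tmul_one, map_smul, ← TensorProduct.smul_tmul', map_smul, braiding_one_tmul,
      revFlip_tmul, reversal_ι, reversal_one]
  | ι u => rw [revFlip_braiding_ι_tmul_ι, reversal_ι]
  | mul x y hx hy =>
    rw [braiding_tmul_mul, reversal_mul, braiding_mul_tmul, ← hx, braiding_ι_tmul]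
    induction braidOne c v x using TensorProduct.induction_on with
    | zero => simp
    | tmul t u =>
      rw [LinearMap.lTensor_tmul, braidOpRight_tmul, revFlip_smul, hy, revFlip_tmul, reversal_ι,
        braidOp_tmul]
    | add X Y hX hY => simp only [map_add, hX, hY]
  | add x y hx hy =>
    simp only [TensorProduct.tmul_add, TensorProduct.add_tmul, map_add, hx, hy]

theorem revFlip_braidOp_of_braiding {x : T}
    (hx : ∀ y, revFlip (braiding c (x ⊗ₜ[k] y)) =
      braiding (flipConj c) (reversal y ⊗ₜ[k] reversal x)) (Z : T ⊗[k] T) :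
    revFlip (braidOp c x Z) = braidOpRight (flipConj c) (reversal x) (revFlip Z) := by
  induction Z using TensorProduct.induction_on with
  | zero => simp
  | tmul y z => rw [braidOp_tmul, revFlip_mulRightSnd, hx, revFlip_tmul, braidOpRight_tmul]
  | add X Y hX hY => simp only [map_add, hX, hY]

theorem revFlip_braiding_tmul (x y : T) :
    revFlip (braiding c (x ⊗ₜ[k] y)) = braiding (flipConj c) (reversal y ⊗ₜ[k] reversal x) := by
  induction x using TensorAlgebra.induction generalizing y with
  | algebraMap r =>
    rw [reversal_algebraMap, Algebra.algebraMap_eq_smul_one, TensorProduct.tmul_smul, map_smul,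
      braiding_tmul_one, ← TensorProduct.smul_tmul', map_smul, map_smul, braiding_one_tmul,
      revFlip_tmul, reversal_one]
  | ι v => rw [revFlip_braiding_ι_tmul, reversal_ι]
  | mul a b ha hb =>
    rw [braiding_mul_tmul, revFlip_braidOp_of_braiding c ha, hb, reversal_mul, braiding_tmul_mul]
  | add a b ha hb =>
    simp only [TensorProduct.tmul_add, TensorProduct.add_tmul, map_add, ha, hb]

theorem revFlip_braiding (X : T ⊗[k] T) :
    revFlip (braiding c X) = braiding (flipConj c) (revFlip X) := by
  induction X using TensorProduct.induction_on with
  | zero => simp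
  | tmul x y => rw [revFlip_braiding_tmul, revFlip_tmul]
  | add X Y hX hY => simp only [map_add, hX, hY]

theorem revFlip_braidOp (x : T) (Z : T ⊗[k] T) :
    revFlip (braidOp c x Z) = braidOpRight (flipConj c) (reversal x) (revFlip Z) :=
  revFlip_braidOp_of_braiding c (revFlip_braiding_tmul c x) Z

theorem revFlip_braidedMul (X Y : T ⊗[k] T) :
    revFlip (braidedMul c (X ⊗ₜ[k] Y)) = braidedMul (flipConj c) (revFlip Y ⊗ₜ[k] revFlip X) := by
  induction X using TensorProduct.induction_on with
  | zero => simp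
  | tmul x y =>
    rw [braidedMul_tmul_left, revFlip_smul, revFlip_braidOp, revFlip_tmul, braidedMul_tmul_right]
  | add X X' h h' =>
    simp only [map_add, TensorProduct.add_tmul, TensorProduct.tmul_add, h, h']

theorem revFlip_comul (x : T) : revFlip (comul c x) = comul (flipConj c) (reversal x) := by
  induction x using TensorAlgebra.induction with
  | algebraMap r =>
    rw [reversal_algebraMap, Algebra.algebraMap_eq_smul_one, map_smul, map_smul, map_smul,
      comul_one, comul_one, revFlip_tmul, reversal_one]
  | ι v => simp [comul_ι, add_comm]
  | mul x y hx hy => rw [comul_mul, revFlip_braidedMul, hx, hy, reversal_mul, comul_mul]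
  | add x y hx hy => simp only [map_add, hx, hy]

theorem counit_reversal (x : T) : counit (k := k) (V := V) (reversal x) = counit x := by
  induction x using TensorAlgebra.induction with
  | algebraMap r => simp
  | ι v => simp
  | mul x y hx hy => rw [reversal_mul, map_mul, map_mul, hx, hy, mul_comm]
  | add x y hx hy => simp only [map_add, hx, hy]

theorem isIsoToOpCop_reversal : IsIsoToOpCop c (reversal (k := k) (V := V)) where
  bijective := Function.Involutive.bijective reversal_reversal
  map_one := reversal_one
  map_mul := reversal_mul
  map_comul x := map_reversal_eq_comm_of_revFlip_eq (revFlip_comul c x)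
  map_counit := counit_reversal
  map_braiding X := map_reversal_eq_comm_of_revFlip_eq (revFlip_braiding c X)

end Reversal

/-! ## Triangular braidings -/

section WordSpans

variable {k V ι : Type*} [Field k] [AddCommGroup V] [Module k V]

local notation "T" => TensorAlgebra k V

theorem map_mem_of_mem_span_image {R M N κ : Type*} [Semiring R] [AddCommMonoid M]
    [AddCommMonoid N] [Module R M] [Module R N] (f : M →ₗ[R] N) {B : κ → M} {A : Set κ}
    {P : Submodule R N} {x : M} (hx : x ∈ Submodule.span R (B '' A))
    (h : ∀ i ∈ A, f (B i) ∈ P) : f x ∈ P :=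
  (Submodule.span_le (p := P.comap f)).2 (Set.forall_mem_image.2 h) hx

theorem tensorAlgebra_basis_eq_lift (b : Module.Basis ι k V) (u : FreeMonoid ι) :
    b.tensorAlgebra u = FreeMonoid.lift (fun i => TensorAlgebra.ι k (b i)) u := by
  classical
  let _ : LinearOrder ι := WellOrderingRel.isWellOrder.linearOrder
  rw [tensorAlgebra_basis_eq_prod, FreeMonoid.lift_apply]

theorem tensorAlgebra_basis_one (b : Module.Basis ι k V) : b.tensorAlgebra 1 = 1 := by
  rw [tensorAlgebra_basis_eq_lift, map_one]

theorem tensorAlgebra_basis_mul (b : Module.Basis ι k V) (u v : FreeMonoid ι) :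
    b.tensorAlgebra (u * v) = b.tensorAlgebra u * b.tensorAlgebra v := by
  simp only [tensorAlgebra_basis_eq_lift, map_mul]

theorem tensorAlgebra_basis_of (b : Module.Basis ι k V) (x : ι) :
    b.tensorAlgebra (.of x) = TensorAlgebra.ι k (b x) := by
  rw [tensorAlgebra_basis_eq_lift, FreeMonoid.lift_eval_of]

theorem tensorAlgebra_basis_pow (b : Module.Basis ι k V) (u : FreeMonoid ι) (n : ℕ) :
    b.tensorAlgebra (u ^ n) = b.tensorAlgebra u ^ n := by
  simp only [tensorAlgebra_basis_eq_lift, map_pow]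

/-- The span in `T(V) ⊗ T(V)` of the tensor products `u ⊗ v` of words, for `(u, v)` in a set. -/
def pairSpan (b : Module.Basis ι k V) (A : Set (FreeMonoid ι × FreeMonoid ι)) :
    Submodule k (T ⊗[k] T) :=
  Submodule.span k ((fun p => b.tensorAlgebra p.1 ⊗ₜ[k] b.tensorAlgebra p.2) '' A)

/-- The span of all `u ⊗ v` of total degree `n` whose left word `u` lies in a set. -/
def leftSpan (b : Module.Basis ι k V) (A : Set (FreeMonoid ι)) (n : ℕ) : Submodule k (T ⊗[k] T) :=
  pairSpan b {p | p.1 ∈ A ∧ p.1.length + p.2.length = n}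

/-- The homogeneous component of degree `n` of `T(V)`. -/
def degreeSpan (b : Module.Basis ι k V) (n : ℕ) : Submodule k T :=
  Submodule.span k (b.tensorAlgebra '' {u | u.length = n})

variable {b : Module.Basis ι k V}

theorem word_mem_degreeSpan (u : FreeMonoid ι) : b.tensorAlgebra u ∈ degreeSpan b u.length :=
  Submodule.subset_span ⟨u, rfl, rfl⟩

theorem tmul_mem_pairSpan {A : Set (FreeMonoid ι × FreeMonoid ι)} {u v : FreeMonoid ι}
    (h : (u, v) ∈ A) : b.tensorAlgebra u ⊗ₜ[k] b.tensorAlgebra v ∈ pairSpan b A :=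
  Submodule.subset_span ⟨(u, v), h, rfl⟩

theorem pairSpan_mono {A B : Set (FreeMonoid ι × FreeMonoid ι)} (h : A ⊆ B) :
    pairSpan b A ≤ pairSpan b B :=
  Submodule.span_mono (Set.image_mono h)

theorem map_mem_of_mem_pairSpan {M : Type*} [AddCommMonoid M] [Module k M]
    (f : T ⊗[k] T →ₗ[k] M) {A : Set (FreeMonoid ι × FreeMonoid ι)} {P : Submodule k M}
    {X : T ⊗[k] T} (hX : X ∈ pairSpan b A)
    (h : ∀ u v, (u, v) ∈ A → f (b.tensorAlgebra u ⊗ₜ[k] b.tensorAlgebra v) ∈ P) : f X ∈ P :=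
  map_mem_of_mem_span_image f hX fun p hp => h p.1 p.2 hp

theorem map_mulLeft_mulRight_mem_pairSpan (u w : FreeMonoid ι)
    {A C : Set (FreeMonoid ι × FreeMonoid ι)} {X : T ⊗[k] T} (hX : X ∈ pairSpan b A)
    (h : ∀ z y, (z, y) ∈ A → (u * z, y * w) ∈ C) :
    TensorProduct.map (LinearMap.mulLeft k (b.tensorAlgebra u))
      (LinearMap.mulRight k (b.tensorAlgebra w)) X ∈ pairSpan b C := by
  refine map_mem_of_mem_pairSpan _ hX fun z y hzy => ?_
  rw [TensorProduct.map_tmul, LinearMap.mulLeft_apply, LinearMap.mulRight_apply,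
    ← tensorAlgebra_basis_mul, ← tensorAlgebra_basis_mul]
  exact tmul_mem_pairSpan (h z y hzy)

theorem smul_mem_pairSpan (u : FreeMonoid ι) {A C : Set (FreeMonoid ι × FreeMonoid ι)}
    {X : T ⊗[k] T} (hX : X ∈ pairSpan b A) (h : ∀ z y, (z, y) ∈ A → (u * z, y) ∈ C) :
    b.tensorAlgebra u • X ∈ pairSpan b C := by
  refine map_mem_of_mem_pairSpan (Module.toModuleEnd k (S := T) (T ⊗[k] T) (b.tensorAlgebra u)) hX
    fun z y hzy => ?_
  rw [Module.toModuleEnd_apply, DistribSMul.toLinearMap_apply, TensorProduct.smul_tmul',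
    smul_eq_mul, ← tensorAlgebra_basis_mul]
  exact tmul_mem_pairSpan (h z y hzy)

theorem mulRightSnd_mem_pairSpan (w : FreeMonoid ι) {A C : Set (FreeMonoid ι × FreeMonoid ι)}
    {X : T ⊗[k] T} (hX : X ∈ pairSpan b A) (h : ∀ z y, (z, y) ∈ A → (z, y * w) ∈ C) :
    mulRightSnd (b.tensorAlgebra w) X ∈ pairSpan b C := by
  refine map_mem_of_mem_pairSpan ((mulRightSnd (b.tensorAlgebra w)).restrictScalars k) hX
    fun z y hzy => ?_
  rw [LinearMap.restrictScalars_apply, mulRightSnd_tmul, ← tensorAlgebra_basis_mul]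
  exact tmul_mem_pairSpan (h z y hzy)

theorem leftSpan_mono {A B : Set (FreeMonoid ι)} (h : A ⊆ B) (n : ℕ) :
    leftSpan b A n ≤ leftSpan b B n :=
  pairSpan_mono fun _ hp => ⟨h hp.1, hp.2⟩

theorem tmul_mem_leftSpan {A : Set (FreeMonoid ι)} {z : FreeMonoid ι} (hz : z ∈ A) {g : T} {n : ℕ}
    (hg : g ∈ degreeSpan b n) : b.tensorAlgebra z ⊗ₜ[k] g ∈ leftSpan b A (z.length + n) :=
  map_mem_of_mem_span_image (TensorProduct.mk k T T (b.tensorAlgebra z)) hg fun _ hu =>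
    tmul_mem_pairSpan ⟨hz, congrArg (z.length + ·) hu⟩

theorem one_tmul_mem_leftSpan {g : T} {n : ℕ} (hg : g ∈ degreeSpan b n) :
    1 ⊗ₜ[k] g ∈ leftSpan b {1} n := by
  simpa [tensorAlgebra_basis_one] using tmul_mem_leftSpan (Set.mem_singleton 1) hg

theorem tmul_one_mem_leftSpan {A : Set (FreeMonoid ι)} {z : FreeMonoid ι} (hz : z ∈ A) :
    b.tensorAlgebra z ⊗ₜ[k] 1 ∈ leftSpan b A z.length := by
  simpa [tensorAlgebra_basis_one] using
    tmul_mem_leftSpan hz (word_mem_degreeSpan (b := b) (1 : FreeMonoid ι))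

theorem mul_mem_span_words {A B C : Set (FreeMonoid ι)} {x y : T}
    (hx : x ∈ Submodule.span k (b.tensorAlgebra '' A))
    (hy : y ∈ Submodule.span k (b.tensorAlgebra '' B)) (h : ∀ u ∈ A, ∀ v ∈ B, u * v ∈ C) :
    x * y ∈ Submodule.span k (b.tensorAlgebra '' C) := by
  refine map_mem_of_mem_span_image ((LinearMap.mul k T).flip y) hx fun u hu => ?_
  refine map_mem_of_mem_span_image (LinearMap.mul k T (b.tensorAlgebra u)) hy fun v hv => ?_
  rw [LinearMap.mul_apply', ← tensorAlgebra_basis_mul]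
  exact Submodule.subset_span ⟨u * v, h u hu v hv, rfl⟩

theorem mul_mem_degreeSpan {x y : T} {m n : ℕ} (hx : x ∈ degreeSpan b m)
    (hy : y ∈ degreeSpan b n) : x * y ∈ degreeSpan b (m + n) :=
  mul_mem_span_words hx hy fun u hu v hv =>
    (FreeMonoid.length_mul u v).trans (congrArg₂ (· + ·) hu hv)

end WordSpans

section BraidScalar

variable {k ι : Type*} [Field k]

/-- The scalar `∏ α xᵢ yⱼ` by which a word `x₁ ⋯ xₘ` moves past a word `y₁ ⋯ yₙ`. -/
def braidScalar (α : ι → ι → k) : FreeMonoid ι →* FreeMonoid ι →* k :=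
  FreeMonoid.lift fun x => FreeMonoid.lift (α x)

theorem braidScalar_of_of (α : ι → ι → k) (x y : ι) :
    braidScalar α (.of x) (.of y) = α x y := by
  simp [braidScalar]

theorem braidScalar_perm (α : ι → ι → k) {t t' : FreeMonoid ι}
    (h : t.toList.Perm t'.toList) : braidScalar α t = braidScalar α t' := by
  simp only [braidScalar, FreeMonoid.lift_apply]
  exact (h.map _).prod_eq

theorem braidScalar_ne_zero {α : ι → ι → k} (h : ∀ x y, α x y ≠ 0) (t z : FreeMonoid ι) :
    braidScalar α t z ≠ 0 := by
  induction t with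
  | one => simp
  | mul t t' ht ht' => simpa using ⟨ht, ht'⟩
  | of x =>
    induction z with
    | one => simp
    | mul z z' hz hz' => simpa using ⟨hz, hz'⟩
    | of y => simpa [braidScalar_of_of] using h x y

end BraidScalar

section Triangular

variable {k V ι : Type*} [Field k] [AddCommGroup V] [Module k V] [LinearOrder ι]

local notation "T" => TensorAlgebra k V

/-- Left triangularity with nonzero scalars: `d (x ⊗ y) ∈ α x y • (y ⊗ x) + ∑_{z > y} z ⊗ V`
for basis vectors `x`, `y`. -/
structure IsLeftTriangular (b : Module.Basis ι k V) (d : V ⊗[k] V ≃ₗ[k] V ⊗[k] V)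
    (α : ι → ι → k) : Prop where
  ne_zero : ∀ x y, α x y ≠ 0
  sub_mem : ∀ x y, d (b x ⊗ₜ[k] b y) - α x y • (b y ⊗ₜ[k] b x) ∈
    Submodule.span k (b.tensorProduct b '' {p | y < p.1})

theorem tmul_mem_span_tensorProduct_basis (b : Module.Basis ι k V) (v : V) {x y : ι}
    (h : x < y) : b y ⊗ₜ[k] v ∈ Submodule.span k (b.tensorProduct b '' {p | x < p.1}) := by
  have hv : v ∈ Submodule.span k (b '' Set.univ) := by
    rw [Set.image_univ, b.span_eq]
    exact Submodule.mem_top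
  refine map_mem_of_mem_span_image (TensorProduct.mk k V V (b y)) hv fun z _ => ?_
  exact Submodule.subset_span ⟨(y, z), h, b.tensorProduct_apply b y z⟩

/-- Dimension count: `c` maps the span of the `x' ⊗ y'` with `x' > x` into its flip, hence onto
it. -/
theorem map_span_eq_map_comm [Fintype ι] {b : Module.Basis ι k V} {c : V ⊗[k] V ≃ₗ[k] V ⊗[k] V}
    {β : ι → ι → k} {w : ι → ι → ι → V}
    (h : ∀ x y, c (b x ⊗ₜ[k] b y) = β x y • (b y ⊗ₜ[k] b x) +
      ∑ z ∈ Finset.univ.filter (x < ·), w x y z ⊗ₜ[k] b z) (x : ι) :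
    (Submodule.span k (b.tensorProduct b '' {p | x < p.1})).map c.toLinearMap =
      (Submodule.span k (b.tensorProduct b '' {p | x < p.1})).map
        (TensorProduct.comm k V V).toLinearMap := by
  have := Module.Finite.of_basis b
  refine Submodule.eq_of_le_of_finrank_eq (Submodule.map_le_iff_le_comap.2 ?_)
    (by rw [LinearEquiv.finrank_map_eq, LinearEquiv.finrank_map_eq])
  refine Submodule.span_le.2 (Set.forall_mem_image.2 fun p (hp : x < p.1) => ?_)
  rw [SetLike.mem_coe, Submodule.mem_comap, LinearEquiv.coe_coe, b.tensorProduct_apply', h]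
  refine add_mem (Submodule.smul_mem _ _ ?_) (sum_mem fun z hz => ?_)
  · exact ⟨b p.1 ⊗ₜ[k] b p.2, tmul_mem_span_tensorProduct_basis b _ hp, rfl⟩
  · exact ⟨b z ⊗ₜ[k] w p.1 p.2 z, tmul_mem_span_tensorProduct_basis b _
      (hp.trans (Finset.mem_filter.1 hz).2), rfl⟩

theorem IsRightTriangular.exists_isLeftTriangular [Fintype ι] {b : Module.Basis ι k V}
    {c : V ⊗[k] V ≃ₗ[k] V ⊗[k] V} (h : IsRightTriangular b c) :
    ∃ α, IsLeftTriangular b (flipConj c) α := by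
  obtain ⟨β, w, hβ⟩ := h
  refine ⟨fun x y => β y x, fun x y hzero => ?_, fun x y => ?_⟩
  · have hc : c (b y ⊗ₜ[k] b x) ∈
        (Submodule.span k (b.tensorProduct b '' {p | y < p.1})).map c.toLinearMap := by
      rw [map_span_eq_map_comm hβ, hβ, hzero, zero_smul, zero_add]
      exact sum_mem fun z hz => ⟨b z ⊗ₜ[k] w y x z,
        tmul_mem_span_tensorProduct_basis b _ (Finset.mem_filter.1 hz).2, rfl⟩
    obtain ⟨X, hX, hXc⟩ := hc
    rw [c.injective hXc, ← b.tensorProduct_apply b, SetLike.mem_coe,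
      Module.Basis.mem_span_image, Module.Basis.repr_self] at hX
    exact lt_irrefl y (hX (by simp : (y, x) ∈ _))
  · have hflip : flipConj c (b x ⊗ₜ[k] b y) = TensorProduct.comm k V V (c (b y ⊗ₜ[k] b x)) := by
      simp [flipConj]
    rw [hflip, hβ, map_add, map_smul, TensorProduct.comm_tmul, add_sub_cancel_left, map_sum]
    exact sum_mem fun z hz => tmul_mem_span_tensorProduct_basis b _ (Finset.mem_filter.1 hz).2

/-- The pairs of words, of the same lengths as `z` and `t`, whose first word diverges upwards from
`z`: the error terms when a triangular braiding is applied to `t ⊗ z`. -/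
def divergingPairs (z t : FreeMonoid ι) : Set (FreeMonoid ι × FreeMonoid ι) :=
  {p | Diverges z p.1 ∧ p.1.length = z.length ∧ p.2.length = t.length}

/-- `z'` has the same length as `z` and is `z` or diverges upwards from `z`. -/
def Raises (z z' : FreeMonoid ι) : Prop :=
  z'.length = z.length ∧ (z' = z ∨ Diverges z z')

theorem Raises.trans_diverges {w z z' : FreeMonoid ι} (hw : Diverges w z) (h : Raises z z') :
    Diverges w z' := by
  rcases h.2 with rfl | h
  exacts [hw, hw.trans h]

section

variable {b : Module.Basis ι k V} {d : V ⊗[k] V ≃ₗ[k] V ⊗[k] V} {α : ι → ι → k}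

theorem mem_pairSpan_raises {X : T ⊗[k] T} {s : k} {t z : FreeMonoid ι}
    (h : X - s • (b.tensorAlgebra z ⊗ₜ[k] b.tensorAlgebra t) ∈ pairSpan b (divergingPairs z t)) :
    X ∈ pairSpan b {p | Raises z p.1 ∧ p.2.length = t.length} := by
  rw [← sub_add_cancel X (s • (b.tensorAlgebra z ⊗ₜ[k] b.tensorAlgebra t))]
  have hle : divergingPairs z t ⊆ {p | Raises z p.1 ∧ p.2.length = t.length} :=
    fun _ hp => ⟨⟨hp.2.1, .inr hp.1⟩, hp.2.2⟩
  exact add_mem (pairSpan_mono hle h)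
    (Submodule.smul_mem _ s (tmul_mem_pairSpan ⟨⟨rfl, .inl rfl⟩, rfl⟩))

theorem braiding_ι_tmul_ι (d : V ⊗[k] V ≃ₗ[k] V ⊗[k] V) (v w : V) :
    braiding d (TensorAlgebra.ι k v ⊗ₜ[k] TensorAlgebra.ι k w) =
      TensorProduct.map (TensorAlgebra.ι k) (TensorAlgebra.ι k) (d (v ⊗ₜ[k] w)) := by
  rw [braiding_ι_tmul, braidOne_ι]
  simp only [LinearMap.lTensor, LinearMap.rTensor, ← LinearMap.comp_apply, ← TensorProduct.map_comp,
    LinearMap.id_comp, LinearMap.comp_id]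

theorem braiding_tmul_mul_sub_mem {t y z : FreeMonoid ι}
    (hy : braiding d (b.tensorAlgebra t ⊗ₜ[k] b.tensorAlgebra y) -
        braidScalar α t y • (b.tensorAlgebra y ⊗ₜ[k] b.tensorAlgebra t) ∈
      pairSpan b (divergingPairs y t))
    (hz : ∀ t' : FreeMonoid ι, t'.length = t.length →
      braiding d (b.tensorAlgebra t' ⊗ₜ[k] b.tensorAlgebra z) -
          braidScalar α t' z • (b.tensorAlgebra z ⊗ₜ[k] b.tensorAlgebra t') ∈
        pairSpan b (divergingPairs z t')) :
    braiding d (b.tensorAlgebra t ⊗ₜ[k] b.tensorAlgebra (y * z)) -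
        braidScalar α t (y * z) • (b.tensorAlgebra (y * z) ⊗ₜ[k] b.tensorAlgebra t) ∈
      pairSpan b (divergingPairs (y * z) t) := by
  have hmain := smul_mem_pairSpan y (hz t rfl) (C := divergingPairs (y * z) t)
    fun z' t' h => ⟨h.1.mul_left y, by simp [h.2.1], h.2.2⟩
  have herr := map_mem_of_mem_pairSpan
    ((braidOpRight d (b.tensorAlgebra z)).restrictScalars k) hy
    (P := pairSpan b (divergingPairs (y * z) t)) fun y' t' h => by
      rw [LinearMap.restrictScalars_apply, braidOpRight_tmul]
      exact smul_mem_pairSpan y' (mem_pairSpan_raises (hz t' h.2.2)) fun z'' t'' h' =>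
        ⟨h.1.mul_mul z z'', by simp [h.2.1, h'.1.1], h'.2.trans h.2.2⟩
  rw [LinearMap.restrictScalars_apply, map_sub, ← braiding_tmul_mul, ← tensorAlgebra_basis_mul,
    LinearMap.map_smul_of_tower, braidOpRight_tmul] at herr
  convert add_mem herr (Submodule.smul_mem _ (braidScalar α t y) hmain) using 1
  rw [map_mul (braidScalar α t), mul_smul, tensorAlgebra_basis_mul,
    ← smul_eq_mul (b.tensorAlgebra y), ← TensorProduct.smul_tmul', smul_sub, smul_sub,
    smul_comm (b.tensorAlgebra y)]
  abel

theorem braiding_mul_tmul_sub_mem {s t z : FreeMonoid ι}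
    (ht : braiding d (b.tensorAlgebra t ⊗ₜ[k] b.tensorAlgebra z) -
        braidScalar α t z • (b.tensorAlgebra z ⊗ₜ[k] b.tensorAlgebra t) ∈
      pairSpan b (divergingPairs z t))
    (hs : ∀ z' : FreeMonoid ι, z'.length = z.length →
      braiding d (b.tensorAlgebra s ⊗ₜ[k] b.tensorAlgebra z') -
          braidScalar α s z' • (b.tensorAlgebra z' ⊗ₜ[k] b.tensorAlgebra s) ∈
        pairSpan b (divergingPairs z' s)) :
    braiding d (b.tensorAlgebra (s * t) ⊗ₜ[k] b.tensorAlgebra z) -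
        braidScalar α (s * t) z • (b.tensorAlgebra z ⊗ₜ[k] b.tensorAlgebra (s * t)) ∈
      pairSpan b (divergingPairs z (s * t)) := by
  have hmain := mulRightSnd_mem_pairSpan t (hs z rfl) (C := divergingPairs z (s * t))
    fun z' s' h => ⟨h.1, h.2.1, by simp [h.2.2]⟩
  have herr := map_mem_of_mem_pairSpan (braidOp d (b.tensorAlgebra s)) ht
    (P := pairSpan b (divergingPairs z (s * t))) fun z' t' h => by
      rw [braidOp_tmul]
      exact mulRightSnd_mem_pairSpan t' (mem_pairSpan_raises (hs z' h.2.1)) fun z'' s' h' =>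
        ⟨h'.1.trans_diverges h.1, h'.1.1.trans h.2.1, by simp [h'.2, h.2.2]⟩
  rw [map_sub, ← braiding_mul_tmul, ← tensorAlgebra_basis_mul, map_smul, braidOp_tmul] at herr
  convert add_mem herr (Submodule.smul_mem _ (braidScalar α t z) hmain) using 1
  rw [map_sub, LinearMap.map_smul_of_tower, mulRightSnd_tmul, ← tensorAlgebra_basis_mul, smul_sub,
    smul_smul, map_mul (braidScalar α), MonoidHom.mul_apply, mul_comm (braidScalar α s z)]
  abel

namespace IsLeftTriangular

variable (hd : IsLeftTriangular b d α)
include hd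

theorem braiding_of_tmul_of_sub_mem (x y : ι) :
    braiding d (b.tensorAlgebra (.of x) ⊗ₜ[k] b.tensorAlgebra (.of y)) -
        α x y • (b.tensorAlgebra (.of y) ⊗ₜ[k] b.tensorAlgebra (.of x)) ∈
      pairSpan b (divergingPairs (.of y) (.of x)) := by
  simp only [tensorAlgebra_basis_of]
  rw [braiding_ι_tmul_ι, ← TensorProduct.map_tmul, ← map_smul, ← map_sub]
  refine map_mem_of_mem_span_image _ (hd.sub_mem x y) fun p (hp : y < p.1) => ?_
  rw [b.tensorProduct_apply', TensorProduct.map_tmul, ← tensorAlgebra_basis_of,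
    ← tensorAlgebra_basis_of]
  exact tmul_mem_pairSpan ⟨fun s => List.Lex.rel hp, rfl, rfl⟩

/-- Induction on both words: in each step, a main term and an error term are braided further, and
neither can lower the left word. -/
theorem braiding_tmul_word_sub_mem (t z : FreeMonoid ι) :
    braiding d (b.tensorAlgebra t ⊗ₜ[k] b.tensorAlgebra z) -
        braidScalar α t z • (b.tensorAlgebra z ⊗ₜ[k] b.tensorAlgebra t) ∈
      pairSpan b (divergingPairs z t) := by
  induction t generalizing z with
  | one => simp [tensorAlgebra_basis_one, braiding_one_tmul]
  | mul s t hs ht => exact braiding_mul_tmul_sub_mem (ht z) fun z' _ => hs z'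
  | of x =>
    induction z generalizing x with
    | one => simp [tensorAlgebra_basis_one, braiding_tmul_one]
    | mul y z hy hz =>
      refine braiding_tmul_mul_sub_mem (hy x) fun t' ht' => ?_
      obtain ⟨x', rfl⟩ := FreeMonoid.length_eq_one.1 ht'
      exact hz x'
    | of y => simpa only [braidScalar_of_of] using hd.braiding_of_tmul_of_sub_mem x y

theorem braiding_tmul_sub_mem {t : FreeMonoid ι} {g : T}
    (hg : g ∈ Submodule.span k (b.tensorAlgebra '' {u | u.toList.Perm t.toList}))
    (z : FreeMonoid ι) :
    braiding d (g ⊗ₜ[k] b.tensorAlgebra z) - braidScalar α t z • (b.tensorAlgebra z ⊗ₜ[k] g) ∈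
      pairSpan b (divergingPairs z t) := by
  refine map_mem_of_mem_span_image
    (braiding d ∘ₗ (TensorProduct.mk k T T).flip (b.tensorAlgebra z) -
      braidScalar α t z • TensorProduct.mk k T T (b.tensorAlgebra z)) hg fun u hu => ?_
  have h := hd.braiding_tmul_word_sub_mem u z
  rwa [braidScalar_perm α hu, divergingPairs,
    show u.length = t.length from List.Perm.length_eq hu] at h

theorem braidedMul_mem {A B C : Set (FreeMonoid ι)} {m n : ℕ} {X Y : T ⊗[k] T}
    (hX : X ∈ leftSpan b A m) (hY : Y ∈ leftSpan b B n)
    (h : ∀ x ∈ A, ∀ z ∈ B, ∀ z', Raises z z' → x * z' ∈ C) :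
    braidedMul d (X ⊗ₜ[k] Y) ∈ leftSpan b C (m + n) := by
  refine map_mem_of_mem_pairSpan
    (braidedMul d ∘ₗ (TensorProduct.mk k (T ⊗[k] T) (T ⊗[k] T)).flip Y) hX fun x y hxy => ?_
  refine map_mem_of_mem_pairSpan (braidedMul d ∘ₗ TensorProduct.mk k (T ⊗[k] T) (T ⊗[k] T)
    (b.tensorAlgebra x ⊗ₜ[k] b.tensorAlgebra y)) hY fun z w hzw => ?_
  rw [LinearMap.comp_apply, TensorProduct.mk_apply, braidedMul_tmul]
  refine map_mulLeft_mulRight_mem_pairSpan x w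
    (mem_pairSpan_raises (hd.braiding_tmul_word_sub_mem y z)) fun z' y' hz' =>
      ⟨h x hxy.1 z hzw.1 z' hz'.1, ?_⟩
  have hlen : z'.length = z.length ∧ y'.length = y.length := ⟨hz'.1.1, hz'.2⟩
  simp only [FreeMonoid.length_mul, hlen, ← hxy.2, ← hzw.2]
  omega

theorem comul_mem {x : T} {n : ℕ} (hx : x ∈ degreeSpan b n) :
    comul d x ∈ leftSpan b Set.univ n := by
  refine map_mem_of_mem_span_image (comul d) hx fun u (hu : u.length = n) => ?_
  subst hu
  clear hx
  induction u with
  | one =>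
    rw [tensorAlgebra_basis_one, comul_one, ← tensorAlgebra_basis_one b]
    exact tmul_mem_pairSpan ⟨trivial, rfl⟩
  | of x =>
    rw [tensorAlgebra_basis_of, comul_ι, ← tensorAlgebra_basis_of]
    exact add_mem (tmul_one_mem_leftSpan trivial)
      (leftSpan_mono (Set.subset_univ _) _ (one_tmul_mem_leftSpan (word_mem_degreeSpan _)))
  | mul u v hu hv =>
    rw [tensorAlgebra_basis_mul, comul_mul, FreeMonoid.length_mul]
    exact hd.braidedMul_mem hu hv fun _ _ _ _ _ _ => trivial

end IsLeftTriangular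

end

end Triangular

/-! ## Lyndon elements -/

section LeadingWord

variable {k V ι : Type*} [Field k] [AddCommGroup V] [Module k V] [LinearOrder ι]

local notation "T" => TensorAlgebra k V

/-- `g` is the sum of the word `w` and a linear combination of larger rearrangements of `w`. -/
def HasLeadingWord (b : Module.Basis ι k V) (w : FreeMonoid ι) (g : T) : Prop :=
  g - b.tensorAlgebra w ∈
    Submodule.span k (b.tensorAlgebra '' {z | z.toList.Perm w.toList ∧ Diverges w z})

variable {b : Module.Basis ι k V}

theorem hasLeadingWord_self (w : FreeMonoid ι) : HasLeadingWord b w (b.tensorAlgebra w) := by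
  simp [HasLeadingWord]

namespace HasLeadingWord

theorem mem_span_perm {w : FreeMonoid ι} {g : T} (h : HasLeadingWord b w g) :
    g ∈ Submodule.span k (b.tensorAlgebra '' {z | z.toList.Perm w.toList}) := by
  rw [← sub_add_cancel g (b.tensorAlgebra w)]
  exact add_mem (Submodule.span_mono (Set.image_mono fun z hz => hz.1) h)
    (Submodule.subset_span ⟨w, .refl _, rfl⟩)

theorem mem_degreeSpan {w : FreeMonoid ι} {g : T} (h : HasLeadingWord b w g) :
    g ∈ degreeSpan b w.length :=
  Submodule.span_mono (Set.image_mono fun _ hz => List.Perm.length_eq hz) h.mem_span_perm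

theorem mul {u v : FreeMonoid ι} {g h : T} (hg : HasLeadingWord b u g)
    (hh : HasLeadingWord b v h) : HasLeadingWord b (u * v) (g * h) := by
  have hsplit : g * h - b.tensorAlgebra (u * v) =
      (g - b.tensorAlgebra u) * h + b.tensorAlgebra u * (h - b.tensorAlgebra v) := by
    rw [tensorAlgebra_basis_mul]
    noncomm_ring
  have hu : b.tensorAlgebra u ∈ Submodule.span k (b.tensorAlgebra '' {u}) :=
    Submodule.subset_span ⟨u, rfl, rfl⟩
  rw [HasLeadingWord, hsplit]
  refine add_mem (mul_mem_span_words hg hh.mem_span_perm fun x hx y hy => ?_)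
    (mul_mem_span_words hu hh fun x hx y hy => ?_)
  · exact ⟨List.Perm.append hx.1 hy, hx.2.mul_mul _ _⟩
  · rw [Set.mem_singleton_iff.1 hx]
    exact ⟨List.Perm.append_left _ hy.1, hy.2.mul_left u⟩

theorem pow {u : FreeMonoid ι} {g : T} (h : HasLeadingWord b u g) (n : ℕ) :
    HasLeadingWord b (u ^ n) (g ^ n) := by
  induction n with
  | zero => simpa [tensorAlgebra_basis_one] using hasLeadingWord_self (b := b) 1
  | succ n ih => simpa only [pow_succ] using ih.mul h

theorem powersProd {G : FreeMonoid ι → T} {q : List (FreeMonoid ι × ℕ)}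
    (h : ∀ x ∈ q, HasLeadingWord b x.1 (G x.1)) :
    HasLeadingWord b (powersProd id q) (powersProd G q) := by
  induction q with
  | nil => simpa [tensorAlgebra_basis_one] using hasLeadingWord_self (b := b) 1
  | cons x q ih =>
    simp only [powersProd_cons]
    exact (ih fun y hy => h y (.tail x hy)).mul ((h x (.head q)).pow x.2)

theorem sub_smul_mul {u v : FreeMonoid ι} {g h : T} (huv : Diverges (u * v) v)
    (hg : HasLeadingWord b u g) (hh : HasLeadingWord b v h) (s : k) :
    HasLeadingWord b (u * v) (g * h - s • (h * g)) := by
  have hperm : (v * u).toList.Perm (u * v).toList := List.perm_append_comm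
  have hvu : Diverges (u * v) (v * u) := huv.mul_right u
  have hmem : h * g ∈
      Submodule.span k (b.tensorAlgebra '' {z | z.toList.Perm (u * v).toList ∧
        Diverges (u * v) z}) := by
    rw [← sub_add_cancel (h * g) (b.tensorAlgebra (v * u))]
    have hle : {z : FreeMonoid ι | z.toList.Perm (v * u).toList ∧ Diverges (v * u) z} ⊆
        {z | z.toList.Perm (u * v).toList ∧ Diverges (u * v) z} :=
      fun _ hz => ⟨hz.1.trans hperm, hvu.trans hz.2⟩
    exact add_mem (Submodule.span_mono (Set.image_mono hle) (hh.mul hg))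
      (Submodule.subset_span ⟨_, ⟨hperm, hvu⟩, rfl⟩)
  rw [HasLeadingWord, sub_right_comm]
  exact sub_mem (hg.mul hh) (Submodule.smul_mem _ s hmem)

end HasLeadingWord

end LeadingWord

section LyndonElements

variable {k V ι : Type*} [Field k] [AddCommGroup V] [Module k V]

local notation "T" => TensorAlgebra k V

section

variable (c : V ⊗[k] V ≃ₗ[k] V ⊗[k] V)

theorem braidedMul_tmul_one_tmul (x : T) (Y : T ⊗[k] T) :
    braidedMul c ((x ⊗ₜ[k] 1) ⊗ₜ[k] Y) = x • Y := by
  rw [braidedMul_tmul_left, map_one, Module.End.one_apply]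

theorem braidedMul_one_tmul_tmul_one (x y : T) :
    braidedMul c ((1 ⊗ₜ[k] x) ⊗ₜ[k] (y ⊗ₜ[k] 1)) = braiding c (x ⊗ₜ[k] y) := by
  rw [braidedMul_tmul, LinearMap.mulLeft_one, LinearMap.mulRight_one, TensorProduct.map_id,
    LinearMap.id_apply]

theorem braidedMul_one_tmul_one_tmul (x y : T) :
    braidedMul c ((1 ⊗ₜ[k] x) ⊗ₜ[k] (1 ⊗ₜ[k] y)) = 1 ⊗ₜ[k] (x * y) := by
  rw [braidedMul_tmul, braiding_tmul_one]
  simp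

theorem comul_mul_eq_of_primitive_parts (g h u v : T) :
    comul c (g * h) = 1 ⊗ₜ[k] (g * h) + u ⊗ₜ[k] h + (u * v) ⊗ₜ[k] 1 +
      (braidedMul c ((1 ⊗ₜ[k] g) ⊗ₜ[k] (comul c h - 1 ⊗ₜ[k] h)) +
        braidedMul c ((u ⊗ₜ[k] 1) ⊗ₜ[k] (comul c h - 1 ⊗ₜ[k] h - v ⊗ₜ[k] 1)) +
        braidedMul c ((comul c g - 1 ⊗ₜ[k] g - u ⊗ₜ[k] 1) ⊗ₜ[k] comul c h)) := by
  simp only [TensorProduct.tmul_sub, TensorProduct.sub_tmul, map_sub,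
    braidedMul_one_tmul_one_tmul, braidedMul_tmul_one_tmul, ← comul_mul,
    TensorProduct.smul_tmul', smul_eq_mul, mul_one]
  abel

theorem comul_mul_eq_of_primitive_part (g h u : T) :
    comul c (h * g) = 1 ⊗ₜ[k] (h * g) + braiding c (h ⊗ₜ[k] u) +
      (braidedMul c ((1 ⊗ₜ[k] h) ⊗ₜ[k] (comul c g - 1 ⊗ₜ[k] g - u ⊗ₜ[k] 1)) +
        braidedMul c ((comul c h - 1 ⊗ₜ[k] h) ⊗ₜ[k] comul c g)) := by
  simp only [TensorProduct.tmul_sub, TensorProduct.sub_tmul, map_sub,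
    braidedMul_one_tmul_one_tmul, braidedMul_one_tmul_tmul_one, ← comul_mul]
  abel

end

variable [LinearOrder ι]

/-- `g` has the leading word `w`, and `Δ g` equals `1 ⊗ g + w ⊗ 1` up to terms whose left word
diverges upwards from `w`. For a Lyndon word `w`, an iterated braided commutator of the letters of
`w` is such an element. -/
structure IsLyndonElement (b : Module.Basis ι k V) (d : V ⊗[k] V ≃ₗ[k] V ⊗[k] V)
    (w : FreeMonoid ι) (g : T) : Prop where
  leading : HasLeadingWord b w g
  comul_sub_mem : comul d g - 1 ⊗ₜ[k] g - b.tensorAlgebra w ⊗ₜ[k] 1 ∈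
    leftSpan b {z | Diverges w z} w.length

variable {b : Module.Basis ι k V} {d : V ⊗[k] V ≃ₗ[k] V ⊗[k] V} {α : ι → ι → k}

theorem IsLyndonElement.comul_sub_one_tmul_mem {w : FreeMonoid ι} {g : T}
    (hg : IsLyndonElement b d w g) :
    comul d g - 1 ⊗ₜ[k] g ∈ leftSpan b {z | z = w ∨ Diverges w z} w.length := by
  rw [← sub_add_cancel (comul d g - 1 ⊗ₜ[k] g) (b.tensorAlgebra w ⊗ₜ[k] 1)]
  exact add_mem (leftSpan_mono (fun _ => .inr) _ hg.comul_sub_mem)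
    (tmul_one_mem_leftSpan (.inl rfl))

theorem isLyndonElement_of (b : Module.Basis ι k V) (d : V ⊗[k] V ≃ₗ[k] V ⊗[k] V) (x : ι) :
    IsLyndonElement b d (.of x) (b.tensorAlgebra (.of x)) := by
  refine ⟨hasLeadingWord_self _, ?_⟩
  rw [tensorAlgebra_basis_of, comul_ι, add_sub_cancel_right, sub_self]
  exact zero_mem _

section

variable (hd : IsLeftTriangular b d α) {u v : FreeMonoid ι} {g h : TensorAlgebra k V}
  (huv : Diverges (u * v) v) (hg : IsLyndonElement b d u g) (hh : IsLyndonElement b d v h)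
include hd huv hg hh

theorem comul_mul_sub_mem_leftSpan :
    comul d (g * h) - (1 ⊗ₜ[k] (g * h) + b.tensorAlgebra u ⊗ₜ[k] h +
        b.tensorAlgebra (u * v) ⊗ₜ[k] 1) ∈
      leftSpan b {z | Diverges (u * v) z} (u * v).length := by
  rw [comul_mul_eq_of_primitive_parts d g h (b.tensorAlgebra u) (b.tensorAlgebra v),
    ← tensorAlgebra_basis_mul, add_sub_cancel_left, FreeMonoid.length_mul]
  refine add_mem (add_mem ?_ ?_) ?_
  · refine hd.braidedMul_mem (one_tmul_mem_leftSpan hg.leading.mem_degreeSpan)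
      hh.comul_sub_one_tmul_mem ?_
    rintro _ rfl z (rfl | hz) z' hz'
    · simpa using hz'.trans_diverges huv
    · simpa using hz'.trans_diverges (huv.trans hz)
  · refine hd.braidedMul_mem (tmul_one_mem_leftSpan rfl) hh.comul_sub_mem ?_
    rintro _ rfl z hz z' hz'
    exact (hz'.trans_diverges hz).mul_left u
  · exact hd.braidedMul_mem hg.comul_sub_mem (hd.comul_mem hh.leading.mem_degreeSpan)
      fun x hx _ _ z' _ => Diverges.mul_mul hx v z'

theorem comul_mul_swap_sub_mem_leftSpan :
    comul d (h * g) -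
        (1 ⊗ₜ[k] (h * g) + braidScalar α v u • (b.tensorAlgebra u ⊗ₜ[k] h)) ∈
      leftSpan b {z | Diverges (u * v) z} (u * v).length := by
  have hle : divergingPairs u v ⊆
      {p | p.1 ∈ {z | Diverges (u * v) z} ∧ p.1.length + p.2.length = v.length + u.length} :=
    fun p hp => ⟨by simpa using hp.1.mul_mul v 1, by rw [hp.2.1, hp.2.2, add_comm]⟩
  have hbraid := pairSpan_mono hle (hd.braiding_tmul_sub_mem hh.leading.mem_span_perm u)
  rw [comul_mul_eq_of_primitive_part d g h (b.tensorAlgebra u), FreeMonoid.length_mul,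
    add_comm u.length, add_sub_right_comm, add_sub_add_left_eq_sub]
  refine add_mem hbraid (add_mem ?_ ?_)
  · refine hd.braidedMul_mem (one_tmul_mem_leftSpan hh.leading.mem_degreeSpan) hg.comul_sub_mem ?_
    rintro _ rfl z hz z' hz'
    simpa using (hz'.trans_diverges hz).mul_mul v 1
  · refine hd.braidedMul_mem hh.comul_sub_one_tmul_mem (hd.comul_mem hg.leading.mem_degreeSpan) ?_
    rintro x (rfl | hx) z - z' -
    · exact huv.mul_right z'
    · exact (huv.trans hx).mul_right z'

/-- The scalar is chosen so that the terms `u ⊗ h` of `Δ(gh)` and `Δ(hg)` cancel. -/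
theorem isLyndonElement_braided_commutator :
    IsLyndonElement b d (u * v) (g * h - (braidScalar α v u)⁻¹ • (h * g)) := by
  refine ⟨hg.leading.sub_smul_mul huv hh.leading _, ?_⟩
  convert sub_mem (comul_mul_sub_mem_leftSpan hd huv hg hh)
    (Submodule.smul_mem _ (braidScalar α v u)⁻¹
      (comul_mul_swap_sub_mem_leftSpan hd huv hg hh)) using 1
  rw [map_sub, map_smul, TensorProduct.tmul_sub, TensorProduct.tmul_smul, smul_sub, smul_add,
    inv_smul_smul₀ (braidScalar_ne_zero hd.ne_zero v u)]
  abel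

end

theorem IsLeftTriangular.exists_isLyndonElement (hd : IsLeftTriangular b d α) {w : FreeMonoid ι}
    (hw : IsLyndon w) : ∃ g, IsLyndonElement b d w g := by
  induction hn : w.length using Nat.strong_induction_on generalizing w with
  | h n ih =>
    have hpos := length_pos_iff.2 hw.1
    rcases (show w.length = 1 ∨ 2 ≤ w.length by omega) with hone | htwo
    · obtain ⟨x, rfl⟩ := FreeMonoid.length_eq_one.1 hone
      exact ⟨_, isLyndonElement_of b d x⟩
    · obtain ⟨u, v, hu, hv, hlt, rfl⟩ := hw.exists_eq_mul htwo
      have hlu := length_pos_iff.2 hu.1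
      have hlv := length_pos_iff.2 hv.1
      rw [FreeMonoid.length_mul] at hn
      obtain ⟨g, hg⟩ := ih u.length (by omega) hu rfl
      obtain ⟨h, hh⟩ := ih v.length (by omega) hv rfl
      have hdiv : Diverges (u * v) v :=
        (hv.mul_lexLT_right hu.1 hlt).diverges (by simp [FreeMonoid.length_mul])
      exact ⟨_, isLyndonElement_braided_commutator hd hdiv hg hh⟩

end LyndonElements

section PowersOfLyndonElements

/-- The words that exceed a power of `v`, or are `v ^ j` with `j < s`. Among the words of length
at most that of `v ^ s`, these are larger than `v ^ s` in the standard order. -/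
def MissesPower {ι : Type*} [LinearOrder ι] (v : FreeMonoid ι) (s : ℕ) (z : FreeMonoid ι) : Prop :=
  PowerDiverges v z ∨ ∃ j < s, z = v ^ j

namespace MissesPower

variable {ι : Type*} [LinearOrder ι] {v z : FreeMonoid ι} {s : ℕ}

theorem mono {s' : ℕ} (hs : s ≤ s') (h : MissesPower v s z) : MissesPower v s' z :=
  h.imp_right fun ⟨j, hj, e⟩ => ⟨j, hj.trans_le hs, e⟩

theorem of_raises {z' : FreeMonoid ι} (h : MissesPower v s z) (hz : Raises z z') :
    MissesPower v s z' := by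
  rcases hz.2 with rfl | hz
  · exact h
  · rcases h with h | ⟨j, -, rfl⟩
    exacts [.inl (h.trans hz), .inl ⟨j, hz⟩]

theorem mul_left (h : MissesPower v s z) : MissesPower v (s + 1) (v * z) := by
  rcases h with h | ⟨j, hj, rfl⟩
  · exact .inl (by simpa using h.pow_mul 1)
  · exact .inr ⟨j + 1, Nat.succ_lt_succ hj, (pow_succ' v j).symm⟩

theorem stdGT (hv : v ≠ 1) (h : MissesPower v s z) (hl : z.length ≤ s * v.length) :
    StdGT z (v ^ s) := by
  have hlen := length_pow v s
  rcases h with h | ⟨j, hj, rfl⟩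
  · rcases hl.lt_or_eq with hl | hl
    · exact .inl (hlen ▸ hl)
    · exact .inr ⟨hl.trans hlen.symm, (h.diverges_pow hl.le).lexLT⟩
  · refine .inl ?_
    rw [length_pow, length_pow]
    exact Nat.mul_lt_mul_of_pos_right hj (length_pos_iff.2 hv)

end MissesPower

variable {k V ι : Type*} [Field k] [AddCommGroup V] [Module k V] [LinearOrder ι]

local notation "T" => TensorAlgebra k V

/-- `x` is homogeneous of degree `n`, and `Δ x` equals `1 ⊗ x` up to terms whose left word exceeds
a power of `v`. -/
structure IsRightPrimitiveAbove (b : Module.Basis ι k V) (d : V ⊗[k] V ≃ₗ[k] V ⊗[k] V)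
    (v : FreeMonoid ι) (n : ℕ) (x : T) : Prop where
  mem_degreeSpan : x ∈ degreeSpan b n
  comul_sub_mem : comul d x - 1 ⊗ₜ[k] x ∈ leftSpan b {z | PowerDiverges v z} n

variable {b : Module.Basis ι k V} {d : V ⊗[k] V ≃ₗ[k] V ⊗[k] V} {α : ι → ι → k}

theorem isRightPrimitiveAbove_one (b : Module.Basis ι k V) (d : V ⊗[k] V ≃ₗ[k] V ⊗[k] V)
    (v : FreeMonoid ι) : IsRightPrimitiveAbove b d v 0 1 := by
  refine ⟨?_, by simp [comul_one]⟩
  simpa [tensorAlgebra_basis_one] using word_mem_degreeSpan (b := b) (1 : FreeMonoid ι)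

theorem IsLyndonElement.isRightPrimitiveAbove {v w : FreeMonoid ι} {g : T} (hv : IsLyndon v)
    (hw : IsLyndon w) (hvw : LexLT v w) (hg : IsLyndonElement b d w g) :
    IsRightPrimitiveAbove b d v w.length g := by
  have h := hv.powerDiverges hw hvw
  refine ⟨hg.leading.mem_degreeSpan, leftSpan_mono ?_ _ hg.comul_sub_one_tmul_mem⟩
  rintro z (rfl | hz)
  exacts [h, h.trans hz]

theorem IsLeftTriangular.comul_mul_sub_mem (hd : IsLeftTriangular b d α) {v : FreeMonoid ι}
    {m n : ℕ} {x y : T} (hx : IsRightPrimitiveAbove b d v m x) (hy : y ∈ degreeSpan b n) :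
    comul d (x * y) - braidedMul d ((1 ⊗ₜ[k] x) ⊗ₜ[k] comul d y) ∈
      leftSpan b {z | PowerDiverges v z} (m + n) := by
  have hmem := hd.braidedMul_mem (C := {z | PowerDiverges v z}) hx.comul_sub_mem (hd.comul_mem hy)
    fun x hx _ _ z' _ => PowerDiverges.mul_right hx z'
  rwa [TensorProduct.sub_tmul, map_sub, ← comul_mul] at hmem

theorem IsLeftTriangular.one_tmul_braidedMul_mem (hd : IsLeftTriangular b d α) {v : FreeMonoid ι}
    {m n s : ℕ} {x : T} {Y : T ⊗[k] T} (hx : x ∈ degreeSpan b m)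
    (hY : Y ∈ leftSpan b {z | MissesPower v s z} n) :
    braidedMul d ((1 ⊗ₜ[k] x) ⊗ₜ[k] Y) ∈ leftSpan b {z | MissesPower v s z} (m + n) := by
  refine hd.braidedMul_mem (one_tmul_mem_leftSpan hx) hY ?_
  rintro _ rfl z hz z' hz'
  simpa using hz.of_raises hz'

theorem leftSpan_powerDiverges_le (v : FreeMonoid ι) (s n : ℕ) :
    leftSpan b {z | PowerDiverges v z} n ≤ leftSpan b {z | MissesPower v s z} n :=
  leftSpan_mono (fun _ => .inl) n

namespace IsRightPrimitiveAbove

theorem mul (hd : IsLeftTriangular b d α) {v : FreeMonoid ι} {m n : ℕ} {x y : T}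
    (hx : IsRightPrimitiveAbove b d v m x) (hy : IsRightPrimitiveAbove b d v n y) :
    IsRightPrimitiveAbove b d v (m + n) (x * y) := by
  refine ⟨mul_mem_degreeSpan hx.mem_degreeSpan hy.mem_degreeSpan, ?_⟩
  have hmem : braidedMul d ((1 ⊗ₜ[k] x) ⊗ₜ[k] (comul d y - 1 ⊗ₜ[k] y)) ∈
      leftSpan b {z | PowerDiverges v z} (m + n) := by
    refine hd.braidedMul_mem (one_tmul_mem_leftSpan hx.mem_degreeSpan) hy.comul_sub_mem ?_
    rintro _ rfl z hz z' hz'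
    rcases hz'.2 with rfl | hz'
    exacts [by simpa using hz, by simpa using hz.trans hz']
  convert add_mem (hd.comul_mul_sub_mem hx hy.mem_degreeSpan) hmem using 1
  rw [TensorProduct.tmul_sub, map_sub, braidedMul_one_tmul_one_tmul]
  abel

theorem pow (hd : IsLeftTriangular b d α) {v : FreeMonoid ι} {m : ℕ} {x : T}
    (hx : IsRightPrimitiveAbove b d v m x) (n : ℕ) :
    IsRightPrimitiveAbove b d v (n * m) (x ^ n) := by
  induction n with
  | zero => simpa using isRightPrimitiveAbove_one b d v
  | succ n ih => simpa only [pow_succ, Nat.succ_mul] using ih.mul hd hx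

theorem powersProd (hd : IsLeftTriangular b d α) {G : FreeMonoid ι → T}
    (hG : ∀ w, IsLyndon w → IsLyndonElement b d w (G w)) {v : FreeMonoid ι} (hv : IsLyndon v)
    {q : List (FreeMonoid ι × ℕ)} (hq : ∀ x ∈ q, IsLyndon x.1 ∧ LexLT v x.1) :
    IsRightPrimitiveAbove b d v (powersProd id q).length (powersProd G q) := by
  induction q with
  | nil => exact isRightPrimitiveAbove_one b d v
  | cons x q ih =>
    obtain ⟨hx, hvx⟩ := hq x (.head q)
    simp only [powersProd_cons, FreeMonoid.length_mul, length_pow, id]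
    exact (ih fun y hy => hq y (.tail x hy)).mul hd
      (((hG _ hx).isRightPrimitiveAbove hv hx hvx).pow hd _)

end IsRightPrimitiveAbove

namespace IsLeftTriangular

variable (hd : IsLeftTriangular b d α) {v : FreeMonoid ι} {g : TensorAlgebra k V}
include hd

theorem braidedMul_tmul_one_tmul_mem {s n : ℕ} {Y : T ⊗[k] T}
    (hY : Y ∈ leftSpan b {z | MissesPower v s z} n) :
    braidedMul d ((b.tensorAlgebra v ⊗ₜ[k] 1) ⊗ₜ[k] Y) ∈
      leftSpan b {z | MissesPower v (s + 1) z} (v.length + n) := by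
  refine hd.braidedMul_mem (tmul_one_mem_leftSpan rfl) hY ?_
  rintro _ rfl z hz z' hz'
  exact (hz.of_raises hz').mul_left

/-- With `A = Δ g` and `B = Δ (g ^ s)`, the product `A * B` is the sum of
`(A - 1 ⊗ g - v ⊗ 1) * B`, `(1 ⊗ g) * B`, `(v ⊗ 1) * (B - v ^ s ⊗ 1)` and `v ^ (s + 1) ⊗ 1`. -/
theorem comul_pow_sub_mem (hg : IsLyndonElement b d v g) (s : ℕ) :
    comul d (g ^ s) - b.tensorAlgebra (v ^ s) ⊗ₜ[k] 1 ∈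
      leftSpan b {z | MissesPower v s z} (s * v.length) := by
  induction s with
  | zero => simp [comul_one, tensorAlgebra_basis_one]
  | succ s ih =>
    have hpow : g ^ s ∈ degreeSpan b (s * v.length) := by
      simpa only [length_pow] using (hg.leading.pow s).mem_degreeSpan
    have hcomul : comul d (g ^ s) ∈ leftSpan b {z | MissesPower v (s + 1) z} (s * v.length) := by
      rw [← sub_add_cancel (comul d (g ^ s)) (b.tensorAlgebra (v ^ s) ⊗ₜ[k] 1), ← length_pow]
      refine add_mem (leftSpan_mono (fun z => MissesPower.mono s.le_succ) _ ?_)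
        (tmul_one_mem_leftSpan (.inr ⟨s, s.lt_succ_self, rfl⟩))
      rwa [length_pow]
    have herror : braidedMul d ((comul d g - 1 ⊗ₜ[k] g - b.tensorAlgebra v ⊗ₜ[k] 1) ⊗ₜ[k]
        comul d (g ^ s)) ∈ leftSpan b {z | MissesPower v (s + 1) z} (v.length + s * v.length) :=
      hd.braidedMul_mem hg.comul_sub_mem (hd.comul_mem hpow) fun x hx _ _ z' _ =>
        .inl ⟨1, by simpa using Diverges.mul_right hx z'⟩
    convert add_mem herror (add_mem (hd.one_tmul_braidedMul_mem hg.leading.mem_degreeSpan hcomul)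
      (hd.braidedMul_tmul_one_tmul_mem ih)) using 1
    · rw [Nat.succ_mul, add_comm (s * v.length)]
    · simp only [pow_succ', comul_mul, TensorProduct.sub_tmul, TensorProduct.tmul_sub, map_sub,
        braidedMul_tmul_one_tmul, TensorProduct.smul_tmul', smul_eq_mul, tensorAlgebra_basis_mul]
      abel

theorem comul_mul_pow_sub_mem (hg : IsLyndonElement b d v g) {t : FreeMonoid ι} {x : T}
    (ht : HasLeadingWord b t x) (hx : IsRightPrimitiveAbove b d v t.length x) (s : ℕ) :
    comul d (x * g ^ s) -
        braidScalar α t (v ^ s) • (b.tensorAlgebra (v ^ s) ⊗ₜ[k] x) ∈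
      leftSpan b {z | MissesPower v s z} (t.length + s * v.length) := by
  have hpow : g ^ s ∈ degreeSpan b (s * v.length) := by
    simpa only [length_pow] using (hg.leading.pow s).mem_degreeSpan
  have hle : divergingPairs (v ^ s) t ⊆ {p | p.1 ∈ {z | MissesPower v s z} ∧
      p.1.length + p.2.length = t.length + s * v.length} :=
    fun p hp => ⟨.inl ⟨s, hp.1⟩, by rw [hp.2.1, hp.2.2, length_pow, add_comm]⟩
  have hbraid := pairSpan_mono hle (hd.braiding_tmul_sub_mem ht.mem_span_perm (v ^ s))
  convert add_mem (leftSpan_powerDiverges_le v s _ (hd.comul_mul_sub_mem hx hpow))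
    (add_mem (hd.one_tmul_braidedMul_mem hx.mem_degreeSpan (hd.comul_pow_sub_mem hg s)) hbraid)
    using 1
  rw [TensorProduct.tmul_sub, map_sub, braidedMul_one_tmul_tmul_one]
  abel

end IsLeftTriangular

end PowersOfLyndonElements

section Contraction

variable {k V ι : Type*} [Field k] [AddCommGroup V] [Module k V]

local notation "T" => TensorAlgebra k V

/-- The contraction of the left tensor factor with a linear form. -/
def contractLeft (f : T →ₗ[k] k) : T ⊗[k] T →ₗ[k] T :=
  (TensorProduct.lid k T).toLinearMap ∘ₗ f.rTensor T

theorem contractLeft_tmul (f : T →ₗ[k] k) (x y : T) :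
    contractLeft f (x ⊗ₜ[k] y) = f x • y := by
  simp [contractLeft]

theorem sumTensor_le_iff {J : Submodule k T} {P : Submodule k (T ⊗[k] T)} :
    sumTensor J ≤ P ↔ (∀ x, ∀ y ∈ J, x ⊗ₜ[k] y ∈ P) ∧ ∀ x ∈ J, ∀ y, x ⊗ₜ[k] y ∈ P := by
  refine ⟨fun h => ⟨fun x y hy => h (Submodule.mem_sup_left ⟨x ⊗ₜ ⟨y, hy⟩, rfl⟩),
    fun x hx y => h (Submodule.mem_sup_right ⟨⟨x, hx⟩ ⊗ₜ y, rfl⟩)⟩, fun h => sup_le ?_ ?_⟩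
  · rw [LinearMap.lTensor, TensorProduct.range_map_eq_span_tmul, Submodule.span_le]
    rintro _ ⟨x, y, rfl⟩
    exact h.1 x y y.2
  · rw [LinearMap.rTensor, TensorProduct.range_map_eq_span_tmul, Submodule.span_le]
    rintro _ ⟨x, y, rfl⟩
    exact h.2 x x.2 y

theorem contractLeft_mem_of_mem_sumTensor {f : T →ₗ[k] k} {J : Submodule k T}
    (hf : J ≤ LinearMap.ker f) {X : T ⊗[k] T} (hX : X ∈ sumTensor J) : contractLeft f X ∈ J := by
  suffices sumTensor J ≤ J.comap (contractLeft f) from this hX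
  refine sumTensor_le_iff.2 ⟨fun x y hy => ?_, fun x hx y => ?_⟩
  · simpa only [Submodule.mem_comap, contractLeft_tmul] using J.smul_mem (f x) hy
  · simp [contractLeft_tmul, LinearMap.mem_ker.1 (hf hx)]

/-- The span of the words of length less than `m`. -/
def lowerSpan (b : Module.Basis ι k V) (m : ℕ) : Submodule k T :=
  Submodule.span k (b.tensorAlgebra '' {w | w.length < m})

theorem contractLeft_mem_lowerSpan {b : Module.Basis ι k V} {f : T →ₗ[k] k}
    {A : Set (FreeMonoid ι)} {m n : ℕ}
    (hf : ∀ z ∈ A, z.length + m ≤ n → f (b.tensorAlgebra z) = 0) {X : T ⊗[k] T}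
    (hX : X ∈ leftSpan b A n) : contractLeft f X ∈ lowerSpan b m := by
  refine map_mem_of_mem_pairSpan (contractLeft f) hX fun z t hzt => ?_
  have hlen : z.length + t.length = n := hzt.2
  rw [contractLeft_tmul]
  by_cases h : z.length + m ≤ n
  · rw [hf z hzt.1 h, zero_smul]
    exact zero_mem _
  · exact Submodule.smul_mem _ _
      (Submodule.subset_span ⟨t, show t.length < m by omega, rfl⟩)

end Contraction

/-! ## Independence of products of Lyndon powers -/

section Independence

variable {k V ι : Type*} [Field k] [AddCommGroup V] [Module k V] [LinearOrder ι]

local notation "T" => TensorAlgebra k V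

/-- The words that are not, modulo `J`, linear combinations of larger words in the standard
order. -/
def IsNormalWord (b : Module.Basis ι k V) (J : Submodule k T) (w : FreeMonoid ι) : Prop :=
  b.tensorAlgebra w ∉ spanAbove b w ⊔ J

/-- Factorizations into powers of Lyndon words that are all normal words. -/
def IsNormalList (b : Module.Basis ι k V) (J : Submodule k T) (q : List (FreeMonoid ι × ℕ)) :
    Prop :=
  IsLyndonList q ∧ ∀ x ∈ q, IsNormalWord b J (x.1 ^ x.2)

theorem exists_minimal_head {Q : Finset (List (FreeMonoid ι × ℕ))} (hne : Q.Nonempty)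
    (hnil : [] ∉ Q) :
    ∃ v r q₀, (v, r) :: q₀ ∈ Q ∧
      ∀ q ∈ Q, ∃ x q', q = x :: q' ∧ (LexLT v x.1 ∨ v = x.1 ∧ x.2 ≤ r) := by
  obtain ⟨q₀, hq₀, hmin⟩ := Q.exists_min_image
    (fun q => (toLex ((q.headD (1, 0)).1.toList, OrderDual.toDual (q.headD (1, 0)).2) :
      Lex (List ι × ℕᵒᵈ))) hne
  obtain ⟨⟨v, r⟩, q₀, rfl⟩ := List.exists_cons_of_ne_nil (ne_of_mem_of_not_mem hq₀ hnil)
  refine ⟨v, r, q₀, hq₀, fun q hq => ?_⟩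
  obtain ⟨x, q, rfl⟩ := List.exists_cons_of_ne_nil (ne_of_mem_of_not_mem hq hnil)
  exact ⟨x, q, rfl, by
    simpa [Prod.Lex.toLex_le_toLex, OrderDual.toDual_le_toDual, LexLT] using hmin _ hq⟩

theorem IsLyndonList.eq_nil_of_length_eq_zero {q : List (FreeMonoid ι × ℕ)} (hq : IsLyndonList q)
    (hl : (powersProd id q).length = 0) : q = [] := by
  rcases q with - | ⟨⟨v, n⟩, q⟩
  · rfl
  · obtain ⟨-, ⟨hv, hn⟩, -⟩ := isLyndonList_cons.1 hq
    have hpos := Nat.mul_pos hn (length_pos_iff.2 hv.1)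
    simp only [powersProd_cons, FreeMonoid.length_mul, length_pow, id] at hl
    omega

variable {b : Module.Basis ι k V} {d : V ⊗[k] V ≃ₗ[k] V ⊗[k] V} {α : ι → ι → k}
  {J : Submodule k (TensorAlgebra k V)} {G : FreeMonoid ι → TensorAlgebra k V}

theorem hasLeadingWord_powersProd (hG : ∀ w, IsLyndon w → IsLyndonElement b d w (G w))
    {q : List (FreeMonoid ι × ℕ)} (hq : IsLyndonList q) :
    HasLeadingWord b (powersProd id q) (powersProd G q) :=
  .powersProd fun x hx => (hG x.1 (hq.2 x hx).1).leading

theorem apply_eq_zero_of_stdGT {f : T →ₗ[k] k} {u z : FreeMonoid ι}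
    (hf : spanAbove b u ≤ LinearMap.ker f) (hz : StdGT z u) : f (b.tensorAlgebra z) = 0 :=
  hf (Submodule.subset_span ⟨z, hz, rfl⟩)

section

variable (hd : IsLeftTriangular b d α) (hG : ∀ w, IsLyndon w → IsLyndonElement b d w (G w))
  {v : FreeMonoid ι} (hv : IsLyndon v) {r m : ℕ} {f : TensorAlgebra k V →ₗ[k] k}
  (hf : spanAbove b (v ^ r) ≤ LinearMap.ker f)

include hv hf in
theorem contractLeft_mem_lowerSpan_of_missesPower {X : T ⊗[k] T}
    (hX : X ∈ leftSpan b {z | MissesPower v r z} (r * v.length + m)) :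
    contractLeft f X ∈ lowerSpan b m :=
  contractLeft_mem_lowerSpan (fun _ hz hl =>
    apply_eq_zero_of_stdGT hf (hz.stdGT hv.1 (Nat.le_of_add_le_add_right hl))) hX

include hd hf in
theorem contractLeft_comul_mem_lowerSpan {x : T} (hx : x ∈ lowerSpan b (r * v.length + m)) :
    contractLeft f (comul d x) ∈ lowerSpan b m := by
  refine map_mem_of_mem_span_image (contractLeft f ∘ₗ comul d) hx fun u hu => ?_
  refine contractLeft_mem_lowerSpan (fun z _ hz => apply_eq_zero_of_stdGT hf (.inl ?_))
    (hd.comul_mem (word_mem_degreeSpan u))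
  have hu : u.length < r * v.length + m := hu
  rw [length_pow]
  omega

include hd hG hv hf

theorem contractLeft_comul_powersProd_mem (hr : 0 < r) {q : List (FreeMonoid ι × ℕ)}
    (hq : ∀ x ∈ q, IsLyndon x.1 ∧ LexLT v x.1)
    (hl : (powersProd id q).length = r * v.length + m) :
    contractLeft f (comul d (powersProd G q)) ∈ lowerSpan b m := by
  have hone : f 1 = 0 := by
    rw [← tensorAlgebra_basis_one b]
    refine apply_eq_zero_of_stdGT hf (.inl ?_)
    rw [length_pow, FreeMonoid.length_one]
    exact Nat.mul_pos hr (length_pos_iff.2 hv.1)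
  have hmem := (IsRightPrimitiveAbove.powersProd hd hG hv hq).comul_sub_mem
  rw [hl] at hmem
  simpa [contractLeft_tmul, hone] using
    contractLeft_mem_lowerSpan_of_missesPower hv hf (leftSpan_powerDiverges_le v r _ hmem)

theorem contractLeft_comul_powersProd_cons_sub_mem {s : ℕ} (hs : s ≤ r)
    {q : List (FreeMonoid ι × ℕ)} (hq : IsLyndonList ((v, s) :: q))
    (hl : (powersProd id ((v, s) :: q)).length = r * v.length + m) :
    contractLeft f (comul d (powersProd G ((v, s) :: q))) -
        (braidScalar α (powersProd id q) (v ^ s) * f (b.tensorAlgebra (v ^ s))) •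
          powersProd G q ∈ lowerSpan b m := by
  obtain ⟨hlt, -, hq⟩ := isLyndonList_cons.1 hq
  have hmem := hd.comul_mul_pow_sub_mem (hG v hv) (hasLeadingWord_powersProd hG hq)
    (.powersProd hd hG hv fun x hx => ⟨(hq.2 x hx).1, hlt x hx⟩) s
  simp only [powersProd_cons, FreeMonoid.length_mul, length_pow, id] at hl
  rw [hl] at hmem
  simpa only [map_sub, map_smul, contractLeft_tmul, smul_smul, powersProd_cons] using
    contractLeft_mem_lowerSpan_of_missesPower hv hf
      (leftSpan_mono (fun _ => MissesPower.mono hs) _ hmem)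

theorem contractLeft_comul_powersProd_mem_of_head {x : FreeMonoid ι × ℕ}
    {q : List (FreeMonoid ι × ℕ)} (hr : 0 < r) (hx : LexLT v x.1 ∨ v = x.1 ∧ x.2 < r)
    (hq : IsLyndonList (x :: q))
    (hl : (powersProd id (x :: q)).length = r * v.length + m) :
    contractLeft f (comul d (powersProd G (x :: q))) ∈ lowerSpan b m := by
  obtain ⟨w, s⟩ := x
  rcases hx with hw | ⟨rfl, hs⟩
  · refine contractLeft_comul_powersProd_mem hd hG hv hf hr (fun y hy => ⟨(hq.2 y hy).1, ?_⟩) hl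
    rcases List.mem_cons.1 hy with rfl | hy
    exacts [hw, hw.trans ((isLyndonList_cons.1 hq).1 y hy)]
  · have hzero : f (b.tensorAlgebra (v ^ s)) = 0 := by
      refine apply_eq_zero_of_stdGT hf (.inl ?_)
      rw [length_pow, length_pow]
      exact Nat.mul_lt_mul_of_pos_right hs (length_pos_iff.2 hv.1)
    simpa [hzero] using contractLeft_comul_powersProd_cons_sub_mem hd hG hv hf hs.le hq hl

/-- The contraction of `Δ` with a functional that detects `v ^ r` strips the head `(v, r)` from the
lists that have it, and lowers the degree of the other products. -/
theorem sum_preimage_cons_mem (hr : 0 < r) (hJ : ∀ x ∈ J, comul d x ∈ sumTensor J)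
    (hfJ : J ≤ LinearMap.ker f) {Q : Finset (List (FreeMonoid ι × ℕ))}
    {a : List (FreeMonoid ι × ℕ) → k}
    (hQ : ∀ q ∈ Q, IsLyndonList q ∧ (powersProd id q).length = r * v.length + m)
    (hhead : ∀ q ∈ Q, ∃ x q', q = x :: q' ∧ (LexLT v x.1 ∨ v = x.1 ∧ x.2 ≤ r))
    (hsum : ∑ q ∈ Q, a q • powersProd G q ∈ lowerSpan b (r * v.length + m) ⊔ J) :
    ∑ q ∈ Q.preimage (List.cons (v, r)) List.cons_injective.injOn,
      (a ((v, r) :: q) * (braidScalar α (powersProd id q) (v ^ r) * f (b.tensorAlgebra (v ^ r)))) •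
        powersProd G q ∈ lowerSpan b m ⊔ J := by
  classical
  let F : T →ₗ[k] T := contractLeft f ∘ₗ comul d
  have hF : F (∑ q ∈ Q, a q • powersProd G q) ∈ lowerSpan b m ⊔ J := by
    obtain ⟨y, hy, z, hz, hyz⟩ := Submodule.mem_sup.1 hsum
    rw [← hyz, map_add]
    exact Submodule.add_mem_sup (contractLeft_comul_mem_lowerSpan hd hf hy)
      (contractLeft_mem_of_mem_sumTensor hfJ (hJ z hz))
  have hother : ∑ q ∈ Q with q ∉ Set.range (List.cons (v, r)), a q • F (powersProd G q) ∈
      lowerSpan b m ⊔ J := by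
    refine sum_mem fun q hq => ?_
    obtain ⟨hqQ, hrange⟩ := Finset.mem_filter.1 hq
    obtain ⟨⟨w, s⟩, q, rfl, hx⟩ := hhead q hqQ
    have hlt : LexLT v w ∨ v = w ∧ s < r := by
      refine hx.imp_right fun h => ⟨h.1, h.2.lt_of_ne ?_⟩
      rintro rfl
      exact hrange ⟨q, by rw [h.1]⟩
    exact Submodule.smul_mem _ _ (Submodule.mem_sup_left
      (contractLeft_comul_powersProd_mem_of_head hd hG hv hf hr hlt (hQ _ hqQ).1 (hQ _ hqQ).2))
  have hcons : ∑ q ∈ Q.preimage (List.cons (v, r)) List.cons_injective.injOn,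
      a ((v, r) :: q) • (F (powersProd G ((v, r) :: q)) -
        (braidScalar α (powersProd id q) (v ^ r) * f (b.tensorAlgebra (v ^ r))) •
          powersProd G q) ∈ lowerSpan b m ⊔ J := by
    refine sum_mem fun q hq => Submodule.smul_mem _ _ (Submodule.mem_sup_left ?_)
    have hq := hQ _ (Finset.mem_preimage.1 hq)
    exact contractLeft_comul_powersProd_cons_sub_mem hd hG hv hf le_rfl hq.1 hq.2
  simp only [smul_sub, Finset.sum_sub_distrib, smul_smul] at hcons
  rw [Finset.sum_preimage' _ _ _ fun q => a q • F (powersProd G q)] at hcons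
  rw [map_sum, ← Finset.sum_filter_add_sum_filter_not Q (· ∈ Set.range (List.cons (v, r)))] at hF
  simp only [map_smul] at hF
  exact (Submodule.sub_mem_iff_right _ ((Submodule.add_mem_iff_left _ hother).1 hF)).1 hcons

end

section

variable (hd : IsLeftTriangular b d α) (hG : ∀ w, IsLyndon w → IsLyndonElement b d w (G w))
  (hJ : ∀ x ∈ J, comul d x ∈ sumTensor J) (hone : (1 : TensorAlgebra k V) ∉ J)

include hone in
theorem eq_empty_of_sum_mem_lowerSpan_zero {Q : Finset (List (FreeMonoid ι × ℕ))}
    {a : List (FreeMonoid ι × ℕ) → k}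
    (hQ : ∀ q ∈ Q, IsLyndonList q ∧ (powersProd id q).length = 0) (ha : ∀ q ∈ Q, a q ≠ 0)
    (hsum : ∑ q ∈ Q, a q • powersProd G q ∈ lowerSpan b 0 ⊔ J) : Q = ∅ := by
  by_contra hne
  obtain rfl : Q = {[]} := Finset.eq_singleton_iff_nonempty_unique_mem.2
    ⟨Finset.nonempty_iff_ne_empty.2 hne,
      fun q hq => (hQ q hq).1.eq_nil_of_length_eq_zero (hQ q hq).2⟩
  refine hone ((J.smul_mem_iff (ha [] (Finset.mem_singleton_self _))).1 ?_)
  simpa [lowerSpan] using hsum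

include hd hG hJ hone

theorem eq_empty_of_sum_mem_lowerSpan_sup (n : ℕ) (Q : Finset (List (FreeMonoid ι × ℕ)))
    (a : List (FreeMonoid ι × ℕ) → k)
    (hQ : ∀ q ∈ Q, IsNormalList b J q ∧ (powersProd id q).length = n) (ha : ∀ q ∈ Q, a q ≠ 0)
    (hsum : ∑ q ∈ Q, a q • powersProd G q ∈ lowerSpan b n ⊔ J) : Q = ∅ := by
  induction n using Nat.strong_induction_on generalizing Q a with
  | h n ih =>
    have hlyndon : ∀ q ∈ Q, IsLyndonList q ∧ (powersProd id q).length = n :=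
      fun q hq => ⟨(hQ q hq).1.1, (hQ q hq).2⟩
    rcases n.eq_zero_or_pos with rfl | hn
    · exact eq_empty_of_sum_mem_lowerSpan_zero hone hlyndon ha hsum
    by_contra hne
    have hnil : [] ∉ Q := fun h => hn.ne (hlyndon _ h).2
    obtain ⟨v, r, q₀, hq₀, hhead⟩ :=
      exists_minimal_head (Finset.nonempty_iff_ne_empty.2 hne) hnil
    obtain ⟨hq₀normal, hq₀len⟩ := hQ _ hq₀
    obtain ⟨-, ⟨hv, hr⟩, -⟩ := isLyndonList_cons.1 hq₀normal.1
    obtain ⟨f, hf0, hf⟩ := Submodule.exists_le_ker_of_notMem (hq₀normal.2 (v, r) (.head q₀))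
    obtain ⟨m, rfl⟩ : ∃ m, n = r * v.length + m := by
      simp only [powersProd_cons, FreeMonoid.length_mul, length_pow, id] at hq₀len
      exact ⟨_, by rw [← hq₀len, add_comm]⟩
    have hstrip := sum_preimage_cons_mem hd hG hv (le_sup_left.trans hf) hr hJ
      (le_sup_right.trans hf) hlyndon hhead hsum
    have hempty := ih m (Nat.lt_add_of_pos_left (Nat.mul_pos hr (length_pos_iff.2 hv.1))) _ _
      (fun q hq => ?_) (fun q hq => ?_) hstrip
    · exact Finset.notMem_empty q₀ (hempty ▸ Finset.mem_preimage.2 hq₀)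
    · obtain ⟨hnormal, hlen⟩ := hQ _ (Finset.mem_preimage.1 hq)
      refine ⟨⟨(isLyndonList_cons.1 hnormal.1).2.2, fun x hx => hnormal.2 x (.tail _ hx)⟩, ?_⟩
      simp only [powersProd_cons, FreeMonoid.length_mul, length_pow, id] at hlen
      omega
    · exact mul_ne_zero (ha _ (Finset.mem_preimage.1 hq))
        (mul_ne_zero (braidScalar_ne_zero hd.ne_zero _ _) hf0)

theorem linearIndepOn_powersProd :
    LinearIndepOn k (J.mkQ ∘ powersProd G) {q | IsNormalList b J q} := by
  classical
  rw [linearIndepOn_iff]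
  intro l hl hsum
  by_contra hne
  obtain ⟨q₀, hq₀, hmax⟩ := l.support.exists_max_image (fun q => (powersProd id q).length)
    (Finsupp.support_nonempty_iff.2 hne)
  set n := (powersProd id q₀).length
  have hsumJ : ∑ q ∈ l.support, l q • powersProd G q ∈ J := by
    rw [← Submodule.Quotient.mk_eq_zero, ← Submodule.mkQ_apply, map_sum]
    simpa [Finsupp.linearCombination_apply, Finsupp.sum] using hsum
  have hlower : ∑ q ∈ l.support with ¬(powersProd id q).length = n, l q • powersProd G q ∈
      lowerSpan b n := by
    refine sum_mem fun q hq => Submodule.smul_mem _ _ ?_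
    obtain ⟨hq, hlen⟩ := Finset.mem_filter.1 hq
    have hle : {u : FreeMonoid ι | u.length = (powersProd id q).length} ⊆ {u | u.length < n} :=
      fun u hu => (show u.length = (powersProd id q).length from hu).trans_lt
        ((hmax q hq).lt_of_ne hlen)
    exact Submodule.span_mono (Set.image_mono hle)
      (hasLeadingWord_powersProd hG (hl hq).1).mem_degreeSpan
  rw [← Finset.sum_filter_add_sum_filter_not l.support fun q => (powersProd id q).length = n]
    at hsumJ
  have hempty := eq_empty_of_sum_mem_lowerSpan_sup hd hG hJ hone n
    (l.support.filter fun q => (powersProd id q).length = n) l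
    (fun q hq => ⟨hl (Finset.mem_filter.1 hq).1, (Finset.mem_filter.1 hq).2⟩)
    (fun q hq => Finsupp.mem_support_iff.1 (Finset.mem_filter.1 hq).1)
    ((Submodule.add_mem_iff_left _ (Submodule.mem_sup_left hlower)).1
      (Submodule.mem_sup_right hsumJ))
  exact Finset.notMem_empty q₀ (hempty ▸ Finset.mem_filter.2 ⟨hq₀, rfl⟩)

end

end Independence

/-! ## Normal words -/

section NormalIndices

variable {k M N κ : Type*} [Field k] [AddCommGroup M] [Module k M] [AddCommGroup N] [Module k N]

theorem map_mem_span_image_iff {B : κ → M} {π : M →ₗ[k] N} {A : Set κ} {x : M} :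
    π x ∈ Submodule.span k ((π ∘ B) '' A) ↔ x ∈ Submodule.span k (B '' A) ⊔ LinearMap.ker π := by
  rw [Set.image_comp, Submodule.span_image, ← Submodule.mem_comap, Submodule.comap_map_eq]

variable (B : κ → M) (r : κ → κ → Prop) (π : M →ₗ[k] N)

theorem map_mem_span_image_notMem_span_sup_ker [IsWellFounded κ r] (i : κ) :
    π (B i) ∈ Submodule.span k
      ((π ∘ B) '' {i | B i ∉ Submodule.span k (B '' {j | r j i}) ⊔ LinearMap.ker π}) := by
  induction i using IsWellFounded.induction r with
  | ind i ih =>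
    by_cases hi : B i ∈ Submodule.span k (B '' {j | r j i}) ⊔ LinearMap.ker π
    · exact Submodule.span_le.2 (Set.forall_mem_image.2 ih) (map_mem_span_image_iff.2 hi)
    · exact Submodule.subset_span ⟨i, hi, rfl⟩

theorem linearIndepOn_notMem_span_sup_ker [IsStrictTotalOrder κ r] :
    LinearIndepOn k (π ∘ B)
      {i | B i ∉ Submodule.span k (B '' {j | r j i}) ⊔ LinearMap.ker π} := by
  classical
  let _ := linearOrderOfSTO r
  refine linearIndepOn_of_finite _ fun t ht hfin => ?_
  lift t to Finset κ using hfin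
  induction t using Finset.induction_on_max with
  | empty => simp
  | insert a t hlt ih =>
    rw [Finset.coe_insert, Set.insert_subset_iff] at ht
    rw [Finset.coe_insert]
    refine (ih ht.2).insert fun hmem => ht.1 ?_
    have hle : Submodule.span k (B '' t) ≤ Submodule.span k (B '' {j | r j a}) :=
      Submodule.span_mono (Set.image_mono hlt)
    exact sup_le_sup_right hle _ (map_mem_span_image_iff.1 hmem)

end NormalIndices

section StandardOrder

variable {ι : Type*} [LinearOrder ι]

theorem StdGT.trans {u v w : FreeMonoid ι} (h : StdGT u v) (h' : StdGT v w) : StdGT u w := by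
  rcases h with h | ⟨h, hl⟩ <;> rcases h' with h' | ⟨h', hl'⟩
  · exact .inl (h.trans h')
  · exact .inl (h' ▸ h)
  · exact .inl (h ▸ h')
  · exact .inr ⟨h.trans h', hl'.trans hl⟩

theorem StdGT.mul_mul {z w : FreeMonoid ι} (h : StdGT z w) (p s : FreeMonoid ι) :
    StdGT (p * z * s) (p * w * s) := by
  rcases h with h | ⟨h, hl⟩
  · exact .inl (by simpa only [FreeMonoid.length_mul, add_lt_add_iff_left, add_lt_add_iff_right])
  · exact .inr ⟨by simp only [FreeMonoid.length_mul, h],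
      (((hl.diverges h.le).mul_left p).mul_mul s s).lexLT⟩

instance isStrictTotalOrder_stdGT : IsStrictTotalOrder (FreeMonoid ι) StdGT where
  irrefl u := by
    rintro (h | ⟨-, h⟩)
    exacts [h.false, LexLT.irrefl u h]
  trans _ _ _ := StdGT.trans
  trichotomous u v hu hv := by
    have hlen : u.length = v.length :=
      le_antisymm (not_lt.1 fun h => hv (.inl h)) (not_lt.1 fun h => hu (.inl h))
    rcases lexLT_trichotomy u v with h | h | h
    exacts [absurd (.inr ⟨hlen.symm, h⟩) hv, h, absurd (.inr ⟨hlen, h⟩) hu]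

theorem lex_gt_of_lt {l m : List ι} (hlen : l.length = m.length) (h : m < l) :
    List.Lex (· > ·) l m := by
  induction l generalizing m with
  | nil => exact absurd h (List.not_lt_nil _)
  | cons x l ih =>
    rcases m with - | ⟨y, m⟩
    · exact absurd hlen (Nat.succ_ne_zero _)
    rcases List.cons_lt_cons_iff.1 h with hxy | ⟨rfl, hlt⟩
    exacts [.rel hxy, .cons (ih (Nat.succ.inj hlen) hlt)]

instance isWellFounded_stdGT [WellFoundedGT ι] : IsWellFounded (FreeMonoid ι) StdGT where
  wf := by
    refine Subrelation.wf (r := InvImage (List.Shortlex (· > ·)) FreeMonoid.toList) ?_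
      (InvImage.wf _ (List.Shortlex.wf wellFounded_gt))
    rintro u w (h | ⟨h, hl⟩)
    · exact .of_length_lt h
    · exact .of_lex h (lex_gt_of_lt h hl)

end StandardOrder

section NormalWords

variable {k V ι : Type*} [Field k] [AddCommGroup V] [Module k V] [LinearOrder ι]

local notation "T" => TensorAlgebra k V

variable {b : Module.Basis ι k V} {J : Ideal (TensorAlgebra k V)}

section

variable [J.IsTwoSided]

theorem IsNormalWord.of_mul {p w s : FreeMonoid ι}
    (h : IsNormalWord b (J.restrictScalars k) (p * w * s)) :
    IsNormalWord b (J.restrictScalars k) w := by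
  contrapose! h
  simp only [IsNormalWord, not_not] at h ⊢
  obtain ⟨x, hx, y, hy, hxy⟩ := Submodule.mem_sup.1 h
  rw [tensorAlgebra_basis_mul, tensorAlgebra_basis_mul, ← hxy, mul_add, add_mul]
  refine Submodule.add_mem_sup ?_ (J.mul_mem_right _ (J.mul_mem_left _ hy))
  refine map_mem_of_mem_span_image
    (LinearMap.mulRight k (b.tensorAlgebra s) ∘ₗ LinearMap.mulLeft k (b.tensorAlgebra p)) hx
    fun z hz => Submodule.subset_span ⟨p * z * s, hz.mul_mul p s, ?_⟩
  simp [tensorAlgebra_basis_mul]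

theorem IsNormalWord.of_pow {v : FreeMonoid ι} {m n : ℕ} (hmn : m ≤ n)
    (h : IsNormalWord b (J.restrictScalars k) (v ^ n)) :
    IsNormalWord b (J.restrictScalars k) (v ^ m) := by
  rw [← Nat.add_sub_of_le hmn, pow_add] at h
  exact .of_mul (p := 1) (by rwa [one_mul])

theorem IsNormalWord.pow_of_mem {q : List (FreeMonoid ι × ℕ)}
    (h : IsNormalWord b (J.restrictScalars k) (powersProd id q)) {x : FreeMonoid ι × ℕ}
    (hx : x ∈ q) : IsNormalWord b (J.restrictScalars k) (x.1 ^ x.2) := by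
  obtain ⟨l₁, l₂, rfl⟩ := List.append_of_mem hx
  refine .of_mul (p := powersProd id l₂) (s := powersProd id l₁) ?_
  simpa [powersProd, mul_assoc] using h

theorem IsNormalWord.exists_isNormalList {w : FreeMonoid ι}
    (hw : IsNormalWord b (J.restrictScalars k) w) :
    ∃ q, IsNormalList b (J.restrictScalars k) q ∧ powersProd id q = w := by
  obtain ⟨q, hq, rfl⟩ := exists_isLyndonList_powersProd w
  exact ⟨q, ⟨hq, fun x hx => hw.pow_of_mem hx⟩, rfl⟩

end

theorem HasLeadingWord.sub_mem_spanAbove {w : FreeMonoid ι} {g : T} (h : HasLeadingWord b w g) :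
    g - b.tensorAlgebra w ∈ spanAbove b w :=
  Submodule.span_mono (Set.image_mono fun _ hz => .inr ⟨hz.1.length_eq, hz.2.lexLT⟩) h

theorem HasLeadingWord.mem_spanAbove_sup_iff {w : FreeMonoid ι} {g : T} {P : Submodule k T}
    (h : HasLeadingWord b w g) :
    g ∈ spanAbove b w ⊔ P ↔ b.tensorAlgebra w ∈ spanAbove b w ⊔ P :=
  ⟨fun hg => (Submodule.sub_mem_iff_right _ hg).1 (Submodule.mem_sup_left h.sub_mem_spanAbove),
    fun hw => (Submodule.sub_mem_iff_left _ hw).1 (Submodule.mem_sup_left h.sub_mem_spanAbove)⟩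

variable {d : V ⊗[k] V ≃ₗ[k] V ⊗[k] V} [J.IsTwoSided]

theorem spanAbove_le_span_powersProd [WellFoundedGT ι] {G : FreeMonoid ι → T}
    (hG : ∀ w, IsLyndon w → IsLyndonElement b d w (G w)) (w : FreeMonoid ι) :
    spanAbove b w ≤ Submodule.span k (powersProd G '' {q | IsNormalList b (J.restrictScalars k) q ∧
      StdGT (powersProd id q) w}) ⊔ J.restrictScalars k := by
  induction w using IsWellFounded.induction (StdGT (ι := ι)) with
  | ind w ih =>
    refine Submodule.span_le.2 (Set.forall_mem_image.2 fun z hz => ?_)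
    have hle : {q | IsNormalList b (J.restrictScalars k) q ∧ StdGT (powersProd id q) z} ⊆
        {q | IsNormalList b (J.restrictScalars k) q ∧ StdGT (powersProd id q) w} :=
      fun q hq => ⟨hq.1, hq.2.trans hz⟩
    have habove := (ih z hz).trans (sup_le_sup_right (Submodule.span_mono (Set.image_mono hle)) _)
    by_cases hnormal : IsNormalWord b (J.restrictScalars k) z
    · obtain ⟨q, hq, rfl⟩ := hnormal.exists_isNormalList
      refine (Submodule.sub_mem_iff_right _ ?_).1
        (habove (hasLeadingWord_powersProd hG hq.1).sub_mem_spanAbove)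
      exact Submodule.mem_sup_left (Submodule.subset_span ⟨q, ⟨hq, hz⟩, rfl⟩)
    · exact sup_le habove le_sup_right (not_not.1 hnormal)

theorem IsNormalList.isNormalWord [WellFoundedGT ι] {α : ι → ι → k} (hd : IsLeftTriangular b d α)
    (hJ : ∀ x ∈ J, comul d x ∈ sumTensor (J.restrictScalars k)) (hone : J ≠ ⊤)
    {q : List (FreeMonoid ι × ℕ)} (hq : IsNormalList b (J.restrictScalars k) q) :
    IsNormalWord b (J.restrictScalars k) (powersProd id q) := by
  choose! G hG using fun w (hw : IsLyndon w) => hd.exists_isLyndonElement hw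
  rw [IsNormalWord, ← (hasLeadingWord_powersProd hG hq.1).mem_spanAbove_sup_iff]
  intro hmem
  have hind := linearIndepOn_powersProd (J := J.restrictScalars k) hd hG hJ
    ((Ideal.ne_top_iff_one J).1 hone)
  set A := {p | IsNormalList b (J.restrictScalars k) p ∧ StdGT (powersProd id p) (powersProd id q)}
  have hA : insert q A ⊆ {p | IsNormalList b (J.restrictScalars k) p} :=
    Set.insert_subset hq fun p hp => hp.1
  have hqA : q ∉ A := fun h => irrefl_of StdGT _ h.2
  refine (hind.mono ((Set.subset_insert q A).trans hA)).notMem_span_iff.2 ⟨hind.mono hA, hqA⟩ ?_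
  refine map_mem_span_image_iff.2 ?_
  rw [Submodule.ker_mkQ]
  exact sup_le (spanAbove_le_span_powersProd hG _) le_sup_right hmem

theorem height_word {P : Submodule k T} (v : FreeMonoid ι) :
    height b P (b.tensorAlgebra v) = wordHeight b P v := by
  simp only [height, b.tensorAlgebra.injective.eq_iff, iInf_iInf_eq_left]

theorem lt_height_iff {v : FreeMonoid ι} {n : ℕ} (hn : 0 < n) :
    n < height b (J.restrictScalars k) (b.tensorAlgebra v) ↔
      IsNormalWord b (J.restrictScalars k) (v ^ n) := by
  rw [height_word, wordHeight]
  constructor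
  · exact fun h hmem => h.not_ge (sInf_le ⟨n, hn, rfl, hmem⟩)
  · refine fun h => (ENat.natCast_lt_natCast.2 n.lt_succ_self).trans_le (le_sInf ?_)
    rintro _ ⟨m, -, rfl, hmem⟩
    exact ENat.natCast_le_natCast.2 (Nat.succ_le_of_lt (not_le.1 fun hmn => h.of_pow hmn hmem))

theorem elemLexLT_word {u v : FreeMonoid ι} :
    ElemLexLT b (b.tensorAlgebra u) (b.tensorAlgebra v) ↔ LexLT u v := by
  simp [ElemLexLT, b.tensorAlgebra.injective.eq_iff]

end NormalWords

/-! ## PBW bases of quotients -/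

section ReversedIdeals

variable {k V : Type*} [Field k] [AddCommGroup V] [Module k V]

local notation "T" => TensorAlgebra k V

theorem revFlip_mem_sumTensor {I : Submodule k T} {X : T ⊗[k] T} (hX : X ∈ sumTensor I) :
    revFlip X ∈ sumTensor (I.map reversal) := by
  suffices sumTensor I ≤ (sumTensor (I.map reversal)).comap revFlip from this hX
  obtain ⟨hleft, hright⟩ := sumTensor_le_iff.1 (le_refl (sumTensor (I.map (reversal (k := k)))))
  exact sumTensor_le_iff.2 ⟨fun x y hy => hright _ (Submodule.mem_map_of_mem hy) (reversal x),
    fun x hx y => hleft (reversal y) _ (Submodule.mem_map_of_mem hx)⟩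

variable (I : Ideal (TensorAlgebra k V)) [I.IsTwoSided]

/-- The image of a two-sided ideal under the word-reversing map. It is encoded as the preimage,
which is the same, since the word-reversing map is an involution. -/
def reversedIdeal : Ideal T where
  carrier := {x | reversal x ∈ I}
  add_mem' hx hy := by simpa using I.add_mem hx hy
  zero_mem' := by simp
  smul_mem' x y hy := by simpa using I.mul_mem_right (reversal x) hy

variable {I}

theorem mem_reversedIdeal {x : T} : x ∈ reversedIdeal I ↔ reversal x ∈ I := Iff.rfl

instance isTwoSided_reversedIdeal : (reversedIdeal I).IsTwoSided where
  mul_mem_of_left y hx := by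
    simpa [mem_reversedIdeal] using I.mul_mem_left (reversal y) (mem_reversedIdeal.1 hx)

theorem restrictScalars_reversedIdeal :
    (reversedIdeal I).restrictScalars k = (I.restrictScalars k).map reversal := by
  ext x
  constructor
  · exact fun hx => ⟨reversal x, hx, reversal_reversal x⟩
  · rintro ⟨x, hx, rfl⟩
    simpa [mem_reversedIdeal] using hx

theorem reversedIdeal_ne_top (hne : I ≠ ⊤) : reversedIdeal I ≠ ⊤ := by
  simpa [Ideal.ne_top_iff_one, mem_reversedIdeal] using hne

theorem comul_mem_sumTensor_reversedIdeal {c : V ⊗[k] V ≃ₗ[k] V ⊗[k] V}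
    (hI : ∀ x ∈ I, comul c x ∈ sumTensor (I.restrictScalars k)) :
    ∀ x ∈ reversedIdeal I, comul (flipConj c) x ∈
      sumTensor ((reversedIdeal I).restrictScalars k) := by
  intro x hx
  rw [restrictScalars_reversedIdeal, ← reversal_reversal x, ← revFlip_comul]
  exact revFlip_mem_sumTensor (hI _ hx)

theorem ker_mkₐ_comp_reversal :
    LinearMap.ker ((Ideal.Quotient.mkₐ k I).toLinearMap ∘ₗ reversal) =
      (reversedIdeal I).restrictScalars k := by
  ext x
  simp [mem_reversedIdeal, Ideal.Quotient.eq_zero_iff_mem]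

end ReversedIdeals

section PBWSets

variable {k A B κ : Type*} [Ring A] {S : Set A} {lt : S → S → Prop} {h : S → ℕ∞}

theorem mem_pbwSet_one_iff_of_equiv (e : κ ≃ S) {a : A} :
    a ∈ pbwSet {1} S lt h ↔ ∃ q : List (κ × ℕ), q.Pairwise (fun x y => lt (e y.1) (e x.1)) ∧
      (∀ x ∈ q, 0 < x.2 ∧ (x.2 : ℕ∞) < h (e x.1)) ∧
        (q.map fun x => (e x.1 : A) ^ x.2).prod = a := by
  simp only [pbwSet, Set.mem_ofPred_eq, Set.mem_singleton_iff, exists_eq_left, mul_one]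
  rw [(List.map_surjective_iff.2 (e.prodCongr (.refl ℕ)).surjective).exists]
  simp only [List.pairwise_map, List.forall_mem_map, List.map_map, Function.comp_def,
    Equiv.prodCongr_apply, Prod.map_fst, Prod.map_snd, Equiv.refl_apply, eq_comm]

variable [Field k] [Algebra k A] [Ring B] [Algebra k B] {π : A →ₐ[k] B}

theorem pbwSet_image_of_equiv {e : S ≃ π '' S} (he : ∀ s : S, (e s : B) = π s) :
    pbwSet {1} (π '' S) (fun x y => lt (e.symm x) (e.symm y)) (fun x => h (e.symm x)) =
      π '' pbwSet {1} S lt h := by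
  ext a
  simp only [mem_pbwSet_one_iff_of_equiv e, Set.mem_image, mem_pbwSet_one_iff_of_equiv (.refl S),
    e.symm_apply_apply, he, Equiv.refl_apply]
  simp [map_list_prod, Function.comp_def, and_assoc]

theorem exists_isPBWBasis_image [IsStrictTotalOrder S lt] (hS : S ⊆ pbwSet {1} S lt h)
    (hind : LinearIndepOn k π (pbwSet {1} S lt h))
    (hspan : Submodule.span k (π '' pbwSet {1} S lt h) = ⊤) :
    ∃ e : S ≃ π '' S, (∀ s : S, (e s : B) = π s) ∧
      IsPBWBasis k {1} (π '' S) (fun x y => lt (e.symm x) (e.symm y)) fun x => h (e.symm x) := by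
  let e := Equiv.Set.imageOfInjOn π S (hind.mono hS).injOn
  have he : ∀ s : S, (e s : B) = π s := fun _ => rfl
  refine ⟨e, he, e.symm.injective.isStrictTotalOrder_onFun (r := lt), ?_, ?_⟩
  · rw [pbwSet_image_of_equiv he]
    exact hind.id_image
  · rw [pbwSet_image_of_equiv he, hspan]

end PBWSets

section Generators

variable {k V ι : Type*} [Field k] [AddCommGroup V] [Module k V]

local notation "T" => TensorAlgebra k V

theorem reversal_word_powersProd (b : Module.Basis ι k V) (q : List (FreeMonoid ι × ℕ)) :
    reversal (b.tensorAlgebra (powersProd id q)) =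
      (q.map fun x => reversal (b.tensorAlgebra x.1) ^ x.2).prod := by
  induction q with
  | nil => simp [tensorAlgebra_basis_one]
  | cons x q ih => simp [tensorAlgebra_basis_mul, tensorAlgebra_basis_pow, reversal_pow, ih]

variable [LinearOrder ι]

/-- The generators of the PBW basis: the reversed Lyndon words that are normal modulo `J`. -/
def pbwGenerators (b : Module.Basis ι k V) (J : Submodule k T) : Set T :=
  reversal ⁻¹' hardWords b J

/-- The order of the generators, opposite to the lexicographical order of the words that they
reverse. -/
def GeneratorLT (b : Module.Basis ι k V) (J : Submodule k T) (s t : pbwGenerators b J) : Prop :=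
  ElemLexLT b (reversal (t : T)) (reversal (s : T))

/-- The height of a generator, which is that of the word that it reverses. -/
def generatorHeight (b : Module.Basis ι k V) (J : Submodule k T) (s : pbwGenerators b J) : ℕ∞ :=
  height b J (reversal (s : T))

/-- The parametrization of the generators by words. -/
def generatorEquiv (b : Module.Basis ι k V) (J : Submodule k T) :
    {v : FreeMonoid ι // IsLyndon v ∧ IsNormalWord b J v} ≃ pbwGenerators b J :=
  .ofBijective (fun v => ⟨reversal (b.tensorAlgebra v), v, v.2, (reversal_reversal _).symm⟩) <| by
    constructor
    · intro v w h
      exact Subtype.ext (b.tensorAlgebra.injective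
        ((Function.Involutive.injective reversal_reversal) (congrArg Subtype.val h)))
    · rintro ⟨x, v, hv, hx⟩
      exact ⟨⟨v, hv⟩, Subtype.ext (by simp [hx])⟩

theorem coe_generatorEquiv (b : Module.Basis ι k V) (J : Submodule k T)
    (v : {v : FreeMonoid ι // IsLyndon v ∧ IsNormalWord b J v}) :
    (generatorEquiv b J v : T) = reversal (b.tensorAlgebra v) := rfl

theorem generatorLT_generatorEquiv {b : Module.Basis ι k V} {J : Submodule k T}
    {v w : {v : FreeMonoid ι // IsLyndon v ∧ IsNormalWord b J v}} :
    GeneratorLT b J (generatorEquiv b J v) (generatorEquiv b J w) ↔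
      LexLT (w : FreeMonoid ι) v := by
  simp only [GeneratorLT, coe_generatorEquiv, reversal_reversal, elemLexLT_word]

instance isStrictTotalOrder_generatorLT (b : Module.Basis ι k V) (J : Submodule k T) :
    IsStrictTotalOrder (pbwGenerators b J) (GeneratorLT b J) where
  irrefl s := by
    obtain ⟨v, rfl⟩ := (generatorEquiv b J).surjective s
    exact generatorLT_generatorEquiv.not.2 (LexLT.irrefl _)
  trans s t u := by
    obtain ⟨v, rfl⟩ := (generatorEquiv b J).surjective s
    obtain ⟨w, rfl⟩ := (generatorEquiv b J).surjective t
    obtain ⟨x, rfl⟩ := (generatorEquiv b J).surjective u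
    simp only [generatorLT_generatorEquiv]
    exact fun h h' => h'.trans h
  trichotomous s t := by
    obtain ⟨v, rfl⟩ := (generatorEquiv b J).surjective s
    obtain ⟨w, rfl⟩ := (generatorEquiv b J).surjective t
    simp only [generatorLT_generatorEquiv]
    exact fun h h' => congrArg _ (Subtype.ext
      (((lexLT_trichotomy _ _).resolve_left h').resolve_right h))

variable {b : Module.Basis ι k V} {J : Ideal (TensorAlgebra k V)} [J.IsTwoSided]

theorem IsNormalList.forall_isNormalWord {q : List (FreeMonoid ι × ℕ)}
    (hq : IsNormalList b (J.restrictScalars k) q) :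
    ∀ x ∈ q, IsLyndon x.1 ∧ IsNormalWord b (J.restrictScalars k) x.1 := fun x hx =>
  ⟨(hq.1.2 x hx).1, by simpa using (hq.2 x hx).of_pow (Nat.succ_le_of_lt (hq.1.2 x hx).2)⟩

theorem mem_pbwSet_generators_iff {a : T} :
    a ∈ pbwSet {1} (pbwGenerators b (J.restrictScalars k)) (GeneratorLT b (J.restrictScalars k))
        (generatorHeight b (J.restrictScalars k)) ↔
      ∃ q, IsNormalList b (J.restrictScalars k) q ∧
        reversal (b.tensorAlgebra (powersProd id q)) = a := by
  rw [mem_pbwSet_one_iff_of_equiv (generatorEquiv b (J.restrictScalars k))]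
  constructor
  · rintro ⟨q, hlt, hq, rfl⟩
    refine ⟨q.map (Prod.map Subtype.val id), ⟨⟨?_, ?_⟩, ?_⟩, ?_⟩
    · simpa only [List.pairwise_map, generatorLT_generatorEquiv, Prod.map_fst] using hlt
    · exact List.forall_mem_map.2 fun x hx => ⟨x.1.2.1, (hq x hx).1⟩
    · refine List.forall_mem_map.2 fun x hx => (lt_height_iff (hq x hx).1).1 ?_
      simpa [generatorHeight, coe_generatorEquiv] using (hq x hx).2
    · simp [reversal_word_powersProd, Function.comp_def, coe_generatorEquiv]
  · rintro ⟨q, hq, rfl⟩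
    obtain ⟨q, rfl⟩ : ∃ p : List ({v // IsLyndon v ∧ IsNormalWord b (J.restrictScalars k) v} × ℕ),
        p.map (Prod.map Subtype.val id) = q := by
      rw [← Set.mem_range, Set.range_list_map]
      exact fun x hx => ⟨(⟨x.1, hq.forall_isNormalWord x hx⟩, x.2), rfl⟩
    have hmem := List.forall_mem_map.1 hq.2
    have hpos := List.forall_mem_map.1 hq.1.2
    refine ⟨q, ?_, fun x hx => ⟨(hpos x hx).2, ?_⟩, ?_⟩
    · simpa only [List.pairwise_map, generatorLT_generatorEquiv, Prod.map_fst] using hq.1.1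
    · simpa [generatorHeight, coe_generatorEquiv] using (lt_height_iff (hpos x hx).2).2 (hmem x hx)
    · simp [reversal_word_powersProd, Function.comp_def, coe_generatorEquiv]

theorem pbwGenerators_subset_pbwSet : pbwGenerators b (J.restrictScalars k) ⊆
    pbwSet {1} (pbwGenerators b (J.restrictScalars k)) (GeneratorLT b (J.restrictScalars k))
      (generatorHeight b (J.restrictScalars k)) := by
  intro x hx
  obtain ⟨⟨v, hv⟩, h⟩ := (generatorEquiv b (J.restrictScalars k)).surjective ⟨x, hx⟩
  refine mem_pbwSet_generators_iff.2 ⟨[(v, 1)],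
    ⟨⟨by simp, by simpa using hv.1⟩, by simpa using hv.2⟩, ?_⟩
  simpa [coe_generatorEquiv] using congrArg Subtype.val h

theorem pbwSet_generators_eq_image [WellFoundedGT ι] {d : V ⊗[k] V ≃ₗ[k] V ⊗[k] V} {α : ι → ι → k}
    (hd : IsLeftTriangular b d α)
    (hJ : ∀ x ∈ J, comul d x ∈ sumTensor (J.restrictScalars k)) (hone : J ≠ ⊤) :
    pbwSet {1} (pbwGenerators b (J.restrictScalars k)) (GeneratorLT b (J.restrictScalars k))
        (generatorHeight b (J.restrictScalars k)) =
      (reversal ∘ b.tensorAlgebra) '' {w | IsNormalWord b (J.restrictScalars k) w} := by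
  ext a
  rw [mem_pbwSet_generators_iff]
  constructor
  · rintro ⟨q, hq, rfl⟩
    exact ⟨_, hq.isNormalWord hd hJ hone, rfl⟩
  · rintro ⟨w, hw, rfl⟩
    obtain ⟨q, hq, rfl⟩ := hw.exists_isNormalList
    exact ⟨q, hq, rfl⟩

variable {I : Ideal (TensorAlgebra k V)} [I.IsTwoSided]

theorem linearIndepOn_reversed_normalWords (b : Module.Basis ι k V) :
    LinearIndepOn k (Ideal.Quotient.mkₐ k I ∘ reversal ∘ b.tensorAlgebra)
      {w | IsNormalWord b ((reversedIdeal I).restrictScalars k) w} := by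
  rw [← ker_mkₐ_comp_reversal]
  exact linearIndepOn_notMem_span_sup_ker _ StdGT
    ((Ideal.Quotient.mkₐ k I).toLinearMap ∘ₗ reversal)

theorem span_image_reversed_normalWords [WellFoundedGT ι] (b : Module.Basis ι k V) :
    Submodule.span k ((Ideal.Quotient.mkₐ k I ∘ reversal ∘ b.tensorAlgebra) ''
      {w | IsNormalWord b ((reversedIdeal I).restrictScalars k) w}) = ⊤ := by
  have hsurj : Function.Surjective ((Ideal.Quotient.mkₐ k I).toLinearMap ∘ₗ reversal (k := k)) :=
    (Ideal.Quotient.mkₐ_surjective k I).comp (Function.Involutive.bijective reversal_reversal).2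
  rw [eq_top_iff, ← LinearMap.range_eq_top.2 hsurj, LinearMap.range_eq_map,
    ← b.tensorAlgebra.span_eq, Submodule.map_span_le, ← ker_mkₐ_comp_reversal]
  exact Set.forall_mem_range.2 fun w => map_mem_span_image_notMem_span_sup_ker _ StdGT _ w

theorem mainTheorem3_general [WellFoundedGT ι] {b : Module.Basis ι k V}
    {c : V ⊗[k] V ≃ₗ[k] V ⊗[k] V} {α : ι → ι → k} (htri : IsLeftTriangular b (flipConj c) α)
    (hI : ∀ x ∈ I, comul c x ∈ sumTensor (I.restrictScalars k)) (hne : I ≠ ⊤) :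
    IsIsoToOpCop c (reversal (k := k) (V := V)) ∧
    (∀ l : List V, reversal (l.map (TensorAlgebra.ι k)).prod =
      (l.reverse.map (TensorAlgebra.ι k)).prod) ∧
    ∃ (S : Set T) (lt : S → S → Prop) (h : S → ℕ∞),
      S = reversal ⁻¹' hardWords b ((I.restrictScalars k).map reversal) ∧
      (∀ s t : S, lt s t ↔ ElemLexLT b (reversal (t : T)) (reversal (s : T))) ∧
      (∀ s : S, h s = height b ((I.restrictScalars k).map reversal) (reversal (s : T))) ∧
      IsStrictTotalOrder S lt ∧
      LinearIndepOn k (Ideal.Quotient.mkₐ k I) (pbwSet {1} S lt h) ∧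
      Submodule.span k (Ideal.Quotient.mkₐ k I '' pbwSet {1} S lt h) = ⊤ ∧
      ∃ e : S ≃ (Ideal.Quotient.mkₐ k I '' S : Set (T ⧸ I)),
        (∀ s : S, (e s : T ⧸ I) = Ideal.Quotient.mkₐ k I (s : T)) ∧
        IsPBWBasis k {1} (Ideal.Quotient.mkₐ k I '' S)
          (fun x y => lt (e.symm x) (e.symm y)) (fun x => h (e.symm x)) := by
  rw [← restrictScalars_reversedIdeal]
  set J : Submodule k T := (reversedIdeal I).restrictScalars k
  have hset : pbwSet {1} (pbwGenerators b J) (GeneratorLT b J) (generatorHeight b J) =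
      (reversal ∘ b.tensorAlgebra) '' {w | IsNormalWord b J w} :=
    pbwSet_generators_eq_image htri (comul_mem_sumTensor_reversedIdeal hI)
      (reversedIdeal_ne_top hne)
  have hind : LinearIndepOn k (Ideal.Quotient.mkₐ k I)
      (pbwSet {1} (pbwGenerators b J) (GeneratorLT b J) (generatorHeight b J)) := by
    rw [hset]
    exact LinearIndepOn.image_of_comp _ _ (linearIndepOn_reversed_normalWords b)
  have hspan : Submodule.span k (Ideal.Quotient.mkₐ k I ''
      pbwSet {1} (pbwGenerators b J) (GeneratorLT b J) (generatorHeight b J)) = ⊤ := by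
    rw [hset, ← Set.image_comp]
    exact span_image_reversed_normalWords b
  exact ⟨isIsoToOpCop_reversal c, reversal_prod, pbwGenerators b J, GeneratorLT b J,
    generatorHeight b J, rfl, fun _ _ => Iff.rfl, fun _ => rfl, isStrictTotalOrder_generatorLT b J,
    hind, hspan, exists_isPBWBasis_image pbwGenerators_subset_pbwSet hind hspan⟩

end Generators

end

end BraidedPBW

theorem mainTheorem3 {k V ι : Type*} [Field k] [AddCommGroup V] [Module k V]
    [Fintype ι] [LinearOrder ι] (b : Module.Basis ι k V)
    (c : V ⊗[k] V ≃ₗ[k] V ⊗[k] V) (hc : BraidedPBW.BraidEquation c)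
    (htri : BraidedPBW.IsRightTriangular b c)
    (I : Ideal (TensorAlgebra k V)) [I.IsTwoSided]
    (hI : BraidedPBW.IsBraidedBiideal c I) (hne : I ≠ ⊤) :
    -- the word-reversing isomorphism of braided bialgebras
    BraidedPBW.IsIsoToOpCop c (BraidedPBW.reversal (k := k) (V := V)) ∧
    (∀ l : List V, BraidedPBW.reversal (l.map (TensorAlgebra.ι k)).prod =
      (l.reverse.map (TensorAlgebra.ι k)).prod) ∧
    -- the PBW basis
    ∃ (S : Set (TensorAlgebra k V)) (lt : S → S → Prop) (h : S → ℕ∞),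
      S = BraidedPBW.reversal ⁻¹'
        BraidedPBW.hardWords b ((I.restrictScalars k).map BraidedPBW.reversal) ∧
      (∀ s t : S, lt s t ↔
        BraidedPBW.ElemLexLT b (BraidedPBW.reversal (t : TensorAlgebra k V))
          (BraidedPBW.reversal (s : TensorAlgebra k V))) ∧
      (∀ s : S, h s = BraidedPBW.height b ((I.restrictScalars k).map BraidedPBW.reversal)
        (BraidedPBW.reversal (s : TensorAlgebra k V))) ∧
      IsStrictTotalOrder S lt ∧
      -- the residue classes of the elements of the PBW set form a basis of the quotient
      LinearIndepOn k (Ideal.Quotient.mkₐ k I) (BraidedPBW.pbwSet {1} S lt h) ∧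
      Submodule.span k (Ideal.Quotient.mkₐ k I '' BraidedPBW.pbwSet {1} S lt h) = ⊤ ∧
      -- the quotient has the PBW basis generated by the residue classes of `S`
      ∃ e : S ≃ (Ideal.Quotient.mkₐ k I '' S : Set (TensorAlgebra k V ⧸ I)),
        (∀ s : S, (e s : TensorAlgebra k V ⧸ I) = Ideal.Quotient.mkₐ k I (s : TensorAlgebra k V)) ∧
        BraidedPBW.IsPBWBasis k {1} (Ideal.Quotient.mkₐ k I '' S)
          (fun x y => lt (e.symm x) (e.symm y)) (fun x => h (e.symm x)) := by
  obtain ⟨α, hleft⟩ := htri.exists_isLeftTriangular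
  exact BraidedPBW.mainTheorem3_general hleft hI.comul_mem hne
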